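/- **Setting.** Let $X$ be a finite nonempty set of $K$ arms; playing arm $x$ yields a utility in $[0,1]$ drawn from a distribution depending only on $x$, with mean $\mu(x)$. In the stochastic multi-armed bandit (MAB) game one arm is played per round, its utility $u_t$ is observed, and the regret after $T$ rounds is $\sum_{t\le T}(\max_z\mu(z)-u_t)$. Put $\Delta_x=\max_z\mu(z)-\mu(x)$. In the utility-based dueling bandits (UBDB) game with linear link, at each step $t$ the algorithm picks $(x_t,y_t)\in X\times X$; independent utilities $u_t,v_t$ of the arms $x_t,y_t$ are drawn but not observed; the algorithm only observes $b_t\in\{0,1\}$, where $\Pr[b_t=1\mid u_t,v_t]=(1+v_t-u_t)/2$. The regret after $T$ steps is $\sum_{t\le T}\bigl(\max_z\mu(z)-(u_t+v_t)/2\bigr)$. A singleton bandit machine (SBM) is a (possibly randomized) MAB policy with memory: *reset* initializes its memory, *advance* returns the next arm, *feedback* gives it a utility in $[0,1]$. MultiSBM uses one reset SBM $S_x$ for each $x\in X$ and an arbitrary arm $y_0$; in step $t$ it sets $x_t=y_{t-1}$, $y_t=\mathrm{advance}(S_{x_t})$, plays $(x_t,y_t)$, and feeds $b_t$ back to $S_{x_t}$.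 For $\alpha>0$, an SBM is $\alpha$-robust if in every MAB environment on $X$, for every number of rounds $T$, every arm $x$ with $\Delta_x>0$ and every real $s>0$ with $s\ge 4\alpha\Delta_x^{-2}\ln T$, the number $T_x$ of times $x$ is played in $T$ rounds satisfies $\Pr[T_x>s]<\frac2\alpha(s/2)^{-\alpha}$. UCB with parameter $\alpha$ plays, in round $t$, an arm maximizing $\hat\mu_x+\sqrt{(\alpha+2)\ln t/(2t_x)}$ (ties broken arbitrarily), where $t_x$ is the number of previous plays of $x$ and $\hat\mu_x$ the average of the rewards obtained from $x$; the index is $\infty$ if $t_x=0$. **Theorem.** There is an absolute constant $C>0$ such that the following holds for every UBDB game with linear link as above with a unique best arm $x^*$ (so $\Delta_x>0$ for $x\ne x^*$). Write $H=\sum_{x\neq x^*}1/\Delta_x$. 1. Let $T\ge 3$ and $\alpha=\max(3,\ln K/\ln\ln T)$. If all the SBMs used by MultiSBM are $\alpha$-robust, then the expected regret of MultiSBM after $T$ steps is at most $$C\Bigl(H\alpha\ln T+H\alpha\bigl(K\ln K+K\ln\ln T-\sum_{x\ne x^*}\ln\Delta_x\bigr)\Bigr).$$ 2. There is $T_0$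 (depending only on the game) such that for all $T\ge T_0$: the expected regret of MultiSBM with $3$-robust SBMs is at most $C\,H\ln T$; and the same bound $C\,H\ln T$ holds for the expected regret of a single UCB with parameter $3$ in the MAB game with the same arms. Moreover, for every finite nonempty $X$ with $K$ arms and every $T\ge3$, UCB with parameter $\alpha=\max(3,\ln K/\ln\ln T)$ is $\alpha$-robust. -/

import Mathlib

open MeasureTheory ProbabilityTheory unitInterval

universe u v

noncomputable section

section Games

variable {X : Type u} [MeasurableSpace X]

/-- An environment over the arms `X` is a Markov kernel `ν : Kernel X I`: playing arm `x` yields a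
utility in `[0, 1]` of law `ν x`. This is the expected utility `μ(x)` of arm `x`. -/
def armMean (ν : Kernel X I) (x : X) : ℝ := ∫ r, (r : ℝ) ∂(ν x)

/-- The gap `Δ_x = max_z μ(z) - μ(x)` (for finitely many arms the supremum is a maximum). -/
def armGap (ν : Kernel X I) (x : X) : ℝ := (⨆ z, armMean ν z) - armMean ν x

/-- The joint law, after `n` rounds, of the final state and the record of the `n` outputs of a
machine which starts in state `s₀` and in each round moves from its state `s` to a new state
while producing an output, the pair being drawn from `κ s`. -/
def runLaw {D O : Type*} [MeasurableSpace D] [MeasurableSpace O] (κ : Kernel D (D × O)) (s₀ : D) :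
    (n : ℕ) → Measure (D × (Fin n → O))
  | 0 => Measure.dirac (s₀, Fin.elim0)
  | n + 1 => (runLaw κ s₀ n ⊗ₘ κ.comap Prod.fst measurable_fst).map
      fun p => (p.2.1, (Fin.snoc p.1.2 p.2.2 : Fin (n + 1) → O))

theorem measurable_snoc_aux {D O : Type*} [MeasurableSpace D] [MeasurableSpace O] (n : ℕ) :
    Measurable fun p : (D × (Fin n → O)) × (D × O) =>
      (p.2.1, (Fin.snoc p.1.2 p.2.2 : Fin (n + 1) → O)) := by
  refine (measurable_fst.comp measurable_snd).prodMk (measurable_pi_lambda _ fun i => ?_)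
  refine Fin.lastCases ?_ (fun j => ?_) i
  · simpa using (by fun_prop : Measurable fun c : (D × (Fin n → O)) × (D × O) => c.2.2)
  · simpa using (by fun_prop : Measurable fun c : (D × (Fin n → O)) × (D × O) => c.1.2 j)

instance runLaw_isProbability {D O : Type*} [MeasurableSpace D] [MeasurableSpace O]
    (κ : Kernel D (D × O)) [IsMarkovKernel κ] (s₀ : D) (n : ℕ) :
    IsProbabilityMeasure (runLaw κ s₀ n) := by
  induction n with
  | zero => unfold runLaw; infer_instance
  | succ n ih =>
    unfold runLaw
    exact Measure.isProbabilityMeasure_map (measurable_snoc_aux n).aemeasurable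

/-! ### Singleton bandit machines and the multi-armed bandit game -/

/-- A singleton bandit machine (SBM) over the arms `X` with memory `M`. `reset` is its initial
memory, `advance` (possibly randomized) returns the next arm and updates the memory, and
`feedback` updates the memory upon receiving a utility in `[0, 1]`. -/
structure SBM (X : Type u) (M : Type v) [MeasurableSpace X] [MeasurableSpace M] where
  reset : M
  advance : Kernel M (M × X)
  markov : IsMarkovKernel advance
  feedback : M × I → M
  measurable_feedback : Measurable feedback

attribute [instance] SBM.markov

variable {M : Type v} [MeasurableSpace M]

/-- One round of the multi-armed bandit game: the machine advances to `(m', x)`, a utility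
`r ∼ ν x` is drawn and fed back. The output of the round is `(x, r)`. -/
def SBM.mabStep (S : SBM X M) (ν : Kernel X I) : Kernel M (M × (X × I)) :=
  (S.advance ⊗ₖ ν.comap (fun p : M × (M × X) => p.2.2)
      (measurable_snd.comp measurable_snd)).map
    fun q => (S.feedback (q.1.1, q.2), (q.1.2, q.2))

instance SBM.mabStep_isMarkov (S : SBM X M) (ν : Kernel X I) [IsMarkovKernel ν] :
    IsMarkovKernel (S.mabStep ν) := by
  have := S.measurable_feedback
  exact Kernel.IsMarkovKernel.map _ (by fun_prop)

/-- The law of `T` rounds of the multi-armed bandit game played by `S` (after a reset) in the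
environment `ν`: final memory, and the record of arms played and utilities received. -/
def SBM.mabLaw (S : SBM X M) (ν : Kernel X I) (T : ℕ) : Measure (M × (Fin T → X × I)) :=
  runLaw (S.mabStep ν) S.reset T

/-- The number of rounds of a record in which arm `x` is played. -/
def playCount {T : ℕ} (x : X) (h : Fin T → X × I) : ℕ := Nat.card {t : Fin T // (h t).1 = x}

/-- `α`-robustness: in every environment, for every number of rounds `T`, every suboptimal arm `x`
and every (positive) `s ≥ 4 α Δ_x⁻² ln T`, `Pr[T_x > s] < (2 / α) (s / 2) ^ (-α)`. -/
def SBM.IsRobust (S : SBM X M) (α : ℝ) : Prop :=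
  ∀ (ν : Kernel X I) [IsMarkovKernel ν] (T : ℕ) (x : X), 0 < armGap ν x →
    ∀ s : ℝ, 0 < s → 4 * α / armGap ν x ^ 2 * Real.log T ≤ s →
      (S.mabLaw ν T).real {p | s < (playCount x p.2 : ℝ)} < 2 / α * (s / 2) ^ (-α)

/-- The expected regret `E[∑_t (μ(x*) - u_t)]` of `S` in `T` rounds of the bandit game. -/
def SBM.mabRegret (S : SBM X M) (ν : Kernel X I) (T : ℕ) : ℝ :=
  ∫ p, ∑ t, ((⨆ z, armMean ν z) - ((p.2 t).2 : ℝ)) ∂(S.mabLaw ν T)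

/-! ### The utility based dueling bandits game -/

/-- The linear link function `(1 + v - u) / 2`. -/
def linearLink (p : I × I) : I :=
  ⟨(1 + (p.2 : ℝ) - (p.1 : ℝ)) / 2, by
    have h1 := p.1.2.1
    have h2 := p.1.2.2
    have h3 := p.2.2.1
    have h4 := p.2.2.2
    constructor <;> linarith⟩

/-- Given utilities `(u, v)`, the choice is `true` (the right arm wins) with probability
`linearLink (u, v)` and `false` (the left arm wins) otherwise. -/
def choiceKernel : Kernel (I × I) Bool where
  toFun p := bernoulliMeasure true false (linearLink p)
  measurable' := by
    have hl : Measurable linearLink := by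
      unfold linearLink
      exact Measurable.subtype_mk (by fun_prop)
    refine Measure.measurable_of_measurable_coe _ fun s hs => ?_
    classical
    simp_rw [bernoulliMeasure_apply _ hs]
    have h1 : Measurable fun p => ((toNNReal (linearLink p) : NNReal) : ENNReal) := by
      refine measurable_coe_nnreal_ennreal.comp ?_
      exact Measurable.subtype_mk (measurable_subtype_coe.comp hl)
    have h2 : Measurable fun p => ((toNNReal (σ (linearLink p)) : NNReal) : ENNReal) := by
      refine measurable_coe_nnreal_ennreal.comp ?_
      refine Measurable.subtype_mk ?_
      exact (measurable_const.sub (measurable_subtype_coe.comp hl))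
    split_ifs
    · exact measurable_const
    · exact h1
    · exact h2
    · exact measurable_const

instance choiceKernel_isMarkov : IsMarkovKernel choiceKernel :=
  ⟨fun p => by
    change IsProbabilityMeasure (bernoulliMeasure true false (linearLink p))
    infer_instance⟩

/-- A duel between the left arm `x` and the right arm `y`: independent utilities `u ∼ ν x` and
`v ∼ ν y`, together with the resulting choice. -/
def duelKernel (ν : Kernel X I) : Kernel (X × X) ((I × I) × Bool) :=
  (ν ∥ₖ ν) ⊗ₖ choiceKernel.comap Prod.snd measurable_snd

instance duelKernel_isMarkov (ν : Kernel X I) [IsMarkovKernel ν] :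
    IsMarkovKernel (duelKernel ν) := by
  unfold duelKernel; infer_instance

/-- An algorithm for dueling bandits with memory `D`: in each round it picks (possibly at random)
a pair (left arm, right arm), updating its memory; then it observes the choice only. -/
structure DuelingAlgorithm (X : Type u) (D : Type*) [MeasurableSpace X] [MeasurableSpace D] where
  start : D
  choose : Kernel D (D × (X × X))
  markov : IsMarkovKernel choose
  observe : D × Bool → D
  measurable_observe : Measurable observe

attribute [instance] DuelingAlgorithm.markov

variable {D : Type*} [MeasurableSpace D]

/-- One round of the dueling game. The output of the round is `((x, y), ((u, v), b))`. -/
def DuelingAlgorithm.duelStep (A : DuelingAlgorithm X D) (ν : Kernel X I) :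
    Kernel D (D × ((X × X) × ((I × I) × Bool))) :=
  (A.choose ⊗ₖ (duelKernel ν).comap (fun p : D × (D × (X × X)) => p.2.2)
      (measurable_snd.comp measurable_snd)).map
    fun q => (A.observe (q.1.1, q.2.2), (q.1.2, q.2))

instance DuelingAlgorithm.duelStep_isMarkov (A : DuelingAlgorithm X D) (ν : Kernel X I)
    [IsMarkovKernel ν] : IsMarkovKernel (A.duelStep ν) := by
  have := A.measurable_observe
  exact Kernel.IsMarkovKernel.map _ (by fun_prop)

/-- The law of `T` rounds of the dueling game played by `A` in the environment `ν`. -/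
def DuelingAlgorithm.gameLaw (A : DuelingAlgorithm X D) (ν : Kernel X I) (T : ℕ) :
    Measure (D × (Fin T → (X × X) × ((I × I) × Bool))) :=
  runLaw (A.duelStep ν) A.start T

/-- The expected regret `E[∑_t (μ(x*) - (u_t + v_t) / 2)]` of `A` in `T` rounds. -/
def DuelingAlgorithm.expectedRegret (A : DuelingAlgorithm X D) (ν : Kernel X I) (T : ℕ) : ℝ :=
  ∫ p, ∑ t, ((⨆ z, armMean ν z) - (((p.2 t).2.1.1 : ℝ) + ((p.2 t).2.1.2 : ℝ)) / 2)
    ∂(A.gameLaw ν T)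

end Games

/-! ### MultiSBM and UCB -/

section Algorithms

variable {X : Type u} [Fintype X] [DecidableEq X] [MeasurableSpace X] [DiscreteMeasurableSpace X]

theorem measurable_update_aux {E M : Type*} [MeasurableSpace E] [MeasurableSpace M]
    {f : E → X → M} {g : E → X} {k : E → M} (hf : Measurable f) (hg : Measurable g)
    (hk : Measurable k) : Measurable fun e => Function.update (f e) (g e) (k e) := by
  refine measurable_pi_lambda _ fun z => ?_
  simp_rw [Function.update_apply]
  refine Measurable.ite ?_ hk ((measurable_pi_apply z).comp hf)
  exact hg (MeasurableSet.of_discrete (s := {a | z = a}))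

theorem measurable_eval_aux {E M : Type*} [MeasurableSpace E] [MeasurableSpace M]
    {f : E → X → M} {g : E → X} (hf : Measurable f) (hg : Measurable g) :
    Measurable fun e => f e (g e) := by
  have h : Measurable fun q : X × (X → M) => q.2 q.1 :=
    measurable_from_prod_countable_right fun x => measurable_pi_apply x
  exact h.comp (hg.prodMk hf)

variable {M : Type v} [MeasurableSpace M]

/-- Advancing the machine `S x` indexed by the left arm `x`. Here `d = ((x', x), mem)`, where
`(x', x)` is the pair played in the previous round and `mem` holds the memories of all machines;
so the right arm `x` of the previous round is the left arm of the coming one. -/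
def multiAdvance (S : X → SBM X M) : Kernel ((X × X) × (X → M)) (M × X) where
  toFun d := (S d.1.2).advance (d.2 d.1.2)
  measurable' := by
    have h : Measurable fun q : X × M => (S q.1).advance q.2 :=
      measurable_from_prod_countable_right fun x => (S x).advance.measurable
    exact h.comp ((measurable_snd.comp measurable_fst).prodMk
      (measurable_eval_aux measurable_snd (measurable_snd.comp measurable_fst)))

instance multiAdvance_isMarkov (S : X → SBM X M) : IsMarkovKernel (multiAdvance S) :=
  ⟨fun d => by
    change IsProbabilityMeasure ((S d.1.2).advance (d.2 d.1.2))
    infer_instance⟩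

/-- MultiSBM: run one machine `S x` per arm `x`, all reset at the beginning, with initial arm `y₀`.
In each round the left arm `x` is the previous right arm, the right arm is suggested by `S x`, and
the observed choice (`1` if the right arm wins, `0` otherwise) is fed back to `S x`. -/
def multiSBM (S : X → SBM X M) (y₀ : X) : DuelingAlgorithm X ((X × X) × (X → M)) where
  start := ((y₀, y₀), fun x => (S x).reset)
  choose := (Kernel.id ×ₖ multiAdvance S).map fun q =>
    (((q.1.1.2, q.2.2), Function.update q.1.2 q.1.1.2 q.2.1), (q.1.1.2, q.2.2))
  markov := Kernel.IsMarkovKernel.map _ <| by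
    refine Measurable.prodMk (Measurable.prodMk (by fun_prop) ?_) (by fun_prop)
    exact measurable_update_aux (by fun_prop) (by fun_prop) (by fun_prop)
  observe p := (p.1.1, Function.update p.1.2 p.1.1.1
    ((S p.1.1.1).feedback (p.1.2 p.1.1.1, bif p.2 then 1 else 0)))
  measurable_observe := by
    refine Measurable.prodMk (by fun_prop) ?_
    refine measurable_update_aux (by fun_prop) (by fun_prop) ?_
    have h : Measurable fun q : X × (M × I) => (S q.1).feedback q.2 :=
      measurable_from_prod_countable_right fun x => (S x).measurable_feedback
    have hb : Measurable fun b : Bool => (bif b then 1 else 0 : I) := measurable_from_top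
    refine h.comp (Measurable.prodMk (by fun_prop) (Measurable.prodMk ?_ ?_))
    · exact measurable_eval_aux (by fun_prop) (by fun_prop)
    · exact hb.comp measurable_snd

/-- The state of UCB: the round counter `t`, the numbers `t_x` of plays, and the sums of the
rewards obtained so far from each arm `x`. -/
abbrev UCBState (X : Type u) : Type u := ℕ × (X → ℕ) × (X → ℝ)

/-- The UCB index `μ̂_x + √((α + 2) ln t / (2 t_x))`, which is `∞` for an arm never played. -/
def ucbIndex (α : ℝ) (m : UCBState X) (x : X) : EReal :=
  if m.2.1 x = 0 then ⊤
  else ((m.2.2 x / m.2.1 x + √((α + 2) * Real.log m.1 / (2 * m.2.1 x)) : ℝ) : EReal)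

/-- `sel` is an arm selection rule of UCB with parameter `α`: it always picks an arm of maximal
index, ties being broken in any (possibly random) way. -/
def IsUCBSelection (α : ℝ) (sel : Kernel (UCBState X) X) : Prop :=
  ∀ m, ∀ᵐ x ∂(sel m), ∀ z, ucbIndex α m z ≤ ucbIndex α m x

/-- The UCB policy as a machine, for a given arm selection rule. The memory consists of the UCB
state and of the arm played last (whose initial value is irrelevant). -/
def ucb [Nonempty X] (sel : Kernel (UCBState X) X) [IsMarkovKernel sel] :
    SBM X (UCBState X × X) where
  reset := ((1, fun _ => 0, fun _ => 0), Classical.arbitrary X)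
  advance := (Kernel.id ×ₖ sel.comap Prod.fst measurable_fst).map
    fun q => ((q.1.1, q.2), q.2)
  markov := Kernel.IsMarkovKernel.map _ (by fun_prop)
  feedback p := ((p.1.1.1 + 1,
    Function.update p.1.1.2.1 p.1.2 (p.1.1.2.1 p.1.2 + 1),
    Function.update p.1.1.2.2 p.1.2 (p.1.1.2.2 p.1.2 + (p.2 : ℝ))), p.1.2)
  measurable_feedback := by
    refine Measurable.prodMk (Measurable.prodMk (by fun_prop) (Measurable.prodMk ?_ ?_))
      (by fun_prop)
    · refine measurable_update_aux (by fun_prop) (by fun_prop) ?_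
      exact (measurable_eval_aux (by fun_prop) (by fun_prop)).add_const 1
    · refine measurable_update_aux (by fun_prop) (by fun_prop) ?_
      exact (measurable_eval_aux (by fun_prop) (by fun_prop)).add
        (measurable_subtype_coe.comp measurable_snd)

/-- `H = ∑_{x ≠ x*} 1 / Δ_x`. -/
def gapComplexity (ν : Kernel X I) (xs : X) : ℝ :=
  ∑ x ∈ Finset.univ.erase xs, 1 / armGap ν x

/-- `max(3, ln K / ln ln T)`. -/
def robustnessParam (K T : ℕ) : ℝ := max 3 (Real.log K / Real.log (Real.log T))

end Algorithms

end

/-! MultiSBM. The left arm of a round is the right arm of the round before, so up to the initial arm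
both sides contribute equally, and the regret is at most `armGap ν y₀` plus `∑ y, Δ_y · E[plays of y
on the right]` (`ae_left_right`, `expectedRegret_le`). The right plays of `y` are split according to
the machine `S x` that suggested them. Although its calls are interleaved with those of other
machines, `S x` sees an ordinary bandit environment, `duelEnv ν x`, in which every gap is halved.
Hence its robustness controls what it suggests in its first `B` calls, for any fixed `B`
(`gameLaw_rightCount_le`, `gameLaw_tail`).

For the machine of the best arm take `B = T`; this gives the leading term of order `α ln T / Δ_y²`.
The machine of a suboptimal `x` is called only after some machine has suggested `x`, and robustness
of all machines makes this rare: with `K ≤ (ln T)^α`, the number of calls exceeds a bound `B`,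
polynomial in `K`, `ln T` and `1 / Δ_x`, with probability at most `2 / (α ln T)`
(`visits_leftArm_tail`). Off that event only `ln B = O(ln K + ln ln T - ln Δ_x)` enters; on it, the
cruder `ln T` estimate is multiplied by the small probability and leaves `O(1 / Δ_y²)`
(`integral_rightCount_le_of_gap`). Summing over `x` and `y` gives `multiSBM_regret_le`. For large
`T` the parameter is `3` and the lower order terms are below `ln T`.

UCB. If a suboptimal arm receives its `(n+1)`-st play while its radius is at most half its gap, then
its mean over exactly `n` plays is too high, or the index of the best arm has fallen to or below its
true mean (`ae_ucbInvariant`). The first is a single event; the second needs a union over rounds `t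
> n` and play counts `k < t`, costing `∑ t · t^(-(α+2)) ≤ n^(-α) / α` (`ucb_tail`). Hoeffding's
inequality is applied to sums stopped at the `k`-th play, through an exponential supermartingale
(`tail_cappedSum`). -/

noncomputable section

/-! ### Expectations and invariants along a run: potentials, almost sure properties, centered
outputs. -/

section RunLaw

variable {D O : Type*} [MeasurableSpace D] [MeasurableSpace O]

theorem lintegral_runLaw_zero (κ : Kernel D (D × O)) (s₀ : D)
    {F : D × (Fin 0 → O) → ENNReal} (hF : Measurable F) :
    ∫⁻ p, F p ∂runLaw κ s₀ 0 = F (s₀, Fin.elim0) := by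
  rw [runLaw, lintegral_dirac' _ hF]

theorem lintegral_runLaw_succ (κ : Kernel D (D × O)) [IsMarkovKernel κ] (s₀ : D) (n : ℕ)
    {F : D × (Fin (n + 1) → O) → ENNReal} (hF : Measurable F) :
    ∫⁻ p, F p ∂runLaw κ s₀ (n + 1) =
      ∫⁻ p, ∫⁻ q, F (q.1, (Fin.snoc p.2 q.2 : Fin (n + 1) → O)) ∂κ p.1 ∂runLaw κ s₀ n := by
  rw [runLaw, lintegral_map hF (measurable_snoc_aux n)]
  refine (Measure.lintegral_compProd (hF.comp (measurable_snoc_aux n))).trans ?_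
  simp [Kernel.comap_apply]

/-- A function of state and history that decreases on average along one step has a final
expectation bounded by its initial value. -/
theorem lintegral_runLaw_le (κ : Kernel D (D × O)) [IsMarkovKernel κ] (s₀ : D)
    {F : ∀ n, D × (Fin n → O) → ENNReal} (hF : ∀ n, Measurable (F n)) (N : ℕ)
    (h : ∀ n < N, ∀ d (h : Fin n → O),
      ∫⁻ q, F (n + 1) (q.1, (Fin.snoc h q.2 : Fin (n + 1) → O)) ∂κ d ≤ F n (d, h)) :
    ∫⁻ p, F N p ∂runLaw κ s₀ N ≤ F 0 (s₀, Fin.elim0) := by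
  induction N with
  | zero => rw [lintegral_runLaw_zero _ _ (hF 0)]
  | succ N ih =>
    rw [lintegral_runLaw_succ _ _ _ (hF _)]
    exact (lintegral_mono fun p : D × (Fin N → O) => h N N.lt_succ_self p.1 p.2).trans
      (ih fun n hn => h n (hn.trans N.lt_succ_self))

/-- The submartingale counterpart, by the same one-step induction. It serves to bound a value
function at the start of a run by its terminal expectation. -/
theorem lintegral_runLaw_ge (κ : Kernel D (D × O)) [IsMarkovKernel κ] (s₀ : D)
    {F : ∀ n, D × (Fin n → O) → ENNReal} (hF : ∀ n, Measurable (F n)) (N : ℕ)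
    (h : ∀ n < N, ∀ d (h : Fin n → O),
      F n (d, h) ≤ ∫⁻ q, F (n + 1) (q.1, (Fin.snoc h q.2 : Fin (n + 1) → O)) ∂κ d) :
    F 0 (s₀, Fin.elim0) ≤ ∫⁻ p, F N p ∂runLaw κ s₀ N := by
  induction N with
  | zero => rw [lintegral_runLaw_zero _ _ (hF 0)]
  | succ N ih =>
    rw [lintegral_runLaw_succ _ _ _ (hF _)]
    exact (ih fun n hn => h n (hn.trans N.lt_succ_self)).trans
      (lintegral_mono fun p : D × (Fin N → O) => h N N.lt_succ_self p.1 p.2)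

/-- A property preserved almost surely by every step holds almost surely at the end. -/
theorem ae_runLaw (κ : Kernel D (D × O)) [IsMarkovKernel κ] (s₀ : D)
    {P : ∀ n, D × (Fin n → O) → Prop} (hP : ∀ n, MeasurableSet {p | P n p})
    (h0 : P 0 (s₀, Fin.elim0))
    (h : ∀ n d (h : Fin n → O), P n (d, h) →
      ∀ᵐ q ∂κ d, P (n + 1) (q.1, (Fin.snoc h q.2 : Fin (n + 1) → O))) (N : ℕ) :
    ∀ᵐ p ∂runLaw κ s₀ N, P N p := by
  -- The indicator of failure is a decreasing potential: it stays zero almost surely while the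
  -- property holds, and once the property fails the bound by `1` is trivial. It starts at zero.
  have hm : ∀ n, Measurable ({p | P n p}ᶜ.indicator (1 : D × (Fin n → O) → ENNReal)) :=
    fun n => measurable_one.indicator (hP n).compl
  have key := lintegral_runLaw_le κ s₀ hm N (fun n _ d hh => by
    by_cases hp : P n (d, hh)
    · refine le_of_eq_of_le ?_ bot_le
      refine (lintegral_eq_zero_iff' ?_).2 ?_
      · refine ((hm (n + 1)).comp ((measurable_snoc_aux n).comp
          (measurable_prodMk_left (x := (d, hh))))).aemeasurable
      · filter_upwards [h n d hh hp] with q hq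
        simp [hq]
    · refine (lintegral_mono (g := fun _ => 1) fun q => ?_).trans ?_
      · simp only [Set.indicator]
        split_ifs <;> simp
      · simp [hp])
  simp only [Set.indicator_of_notMem (show (s₀, Fin.elim0) ∉ {p | P 0 p}ᶜ by simpa using h0),
    nonpos_iff_eq_zero] at key
  rw [lintegral_indicator_one (hP N).compl] at key
  exact key

theorem integral_runLaw_succ (κ : Kernel D (D × O)) [IsMarkovKernel κ] (s₀ : D) (n : ℕ)
    {F : D × (Fin (n + 1) → O) → ℝ} (hF : Measurable F) {C : ℝ} (hC : ∀ p, |F p| ≤ C) :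
    ∫ p, F p ∂runLaw κ s₀ (n + 1) =
      ∫ p, ∫ q, F (q.1, (Fin.snoc p.2 q.2 : Fin (n + 1) → O)) ∂κ p.1 ∂runLaw κ s₀ n := by
  rw [runLaw, integral_map (measurable_snoc_aux n).aemeasurable hF.aestronglyMeasurable,
    Measure.integral_compProd]
  · simp [Kernel.comap_apply]
  · exact Integrable.of_bound (hF.comp (measurable_snoc_aux n)).aestronglyMeasurable C
      (Filter.Eventually.of_forall fun p => hC _)

/-- Outputs that are centered in every state have a sum with vanishing expectation. -/
theorem integral_sum_runLaw_eq_zero (κ : Kernel D (D × O)) [IsMarkovKernel κ] (s₀ : D)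
    {g : O → ℝ} (hg : Measurable g) {C : ℝ} (hC : ∀ o, |g o| ≤ C)
    (h : ∀ d, ∫ q, g q.2 ∂κ d = 0) (N : ℕ) :
    ∫ p, ∑ t, g (p.2 t) ∂runLaw κ s₀ N = 0 := by
  induction N with
  | zero => simp
  | succ N ih =>
    have hm : Measurable fun p : D × (Fin (N + 1) → O) => ∑ t, g (p.2 t) := by fun_prop
    rw [integral_runLaw_succ κ s₀ N hm (C := (N + 1 : ℕ) * C), ← ih]
    · refine integral_congr_ae (Filter.Eventually.of_forall fun p => ?_)
      simp only [Fin.sum_univ_castSucc, Fin.snoc_castSucc, Fin.snoc_last]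
      rw [integral_add (integrable_const _), h]
      · simp
      · exact Integrable.of_bound (hg.comp measurable_snd).aestronglyMeasurable C
          (Filter.Eventually.of_forall fun q => hC _)
    · intro p
      refine (Finset.abs_sum_le_sum_abs _ _).trans ?_
      refine (Finset.sum_le_sum fun t _ => hC (p.2 t)).trans ?_
      simp

end RunLaw

/-! ### Sums over the first visits of a record to a set. -/

section Visits

variable {O : Type*}

open Classical in
/-- The number of times a record visits the set `A`. -/
def visits (A : Set O) {n : ℕ} (h : Fin n → O) : ℕ := ∑ t, if h t ∈ A then 1 else 0

open Classical in
/-- The sum of the weights `w` over the first `k` visits of a record to the set `A`. -/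
def cappedSum (A : Set O) (w : O → ℝ) (k : ℕ) : ∀ n, (Fin n → O) → ℝ
  | 0, _ => 0
  | n + 1, h => cappedSum A w k n (Fin.init h) +
      if h (Fin.last n) ∈ A ∧ visits A (Fin.init h) < k then w (h (Fin.last n)) else 0

@[simp] theorem visits_zero (A : Set O) (h : Fin 0 → O) : visits A h = 0 := by simp [visits]

open Classical in
theorem visits_snoc (A : Set O) {n : ℕ} (h : Fin n → O) (o : O) :
    visits A (Fin.snoc h o : Fin (n + 1) → O) = visits A h + if o ∈ A then 1 else 0 := by
  simp only [visits, Fin.sum_univ_castSucc, Fin.snoc_castSucc, Fin.snoc_last]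

@[simp] theorem cappedSum_zero (A : Set O) (w : O → ℝ) (k : ℕ) (h : Fin 0 → O) :
    cappedSum A w k 0 h = 0 := rfl

open Classical in
theorem cappedSum_snoc (A : Set O) (w : O → ℝ) (k : ℕ) {n : ℕ} (h : Fin n → O) (o : O) :
    cappedSum A w k (n + 1) (Fin.snoc h o) =
      cappedSum A w k n h + if o ∈ A ∧ visits A h < k then w o else 0 := by
  simp [cappedSum]

theorem snoc_induction {P : ∀ n, (Fin n → O) → Prop} (h0 : ∀ h, P 0 h)
    (hs : ∀ n (h : Fin n → O) o, P n h → P (n + 1) (Fin.snoc h o)) :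
    ∀ n h, P n h := by
  intro n
  induction n with
  | zero => exact h0
  | succ n ih =>
    intro h
    rw [← Fin.snoc_init_self h]
    exact hs n _ _ (ih _)

theorem visits_le (A : Set O) {n : ℕ} (h : Fin n → O) : visits A h ≤ n := by
  classical
  refine (Finset.sum_le_sum fun t _ => ?_).trans (b := ∑ _t : Fin n, 1) (by simp)
  split_ifs <;> simp

open Classical in
/-- As long as the cap is not exceeded, the capped sum is the full sum. -/
theorem cappedSum_eq_sum (A : Set O) (w : O → ℝ) (k : ℕ) {n : ℕ} (h : Fin n → O)
    (hk : visits A h ≤ k) :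
    cappedSum A w k n h = ∑ t, if h t ∈ A then w (h t) else 0 := by
  revert hk
  refine snoc_induction (P := fun n h => visits A h ≤ k →
    cappedSum A w k n h = ∑ t, if h t ∈ A then w (h t) else 0) (by simp) ?_ n h
  intro n h o ih hk
  rw [visits_snoc] at hk
  rw [cappedSum_snoc, ih (by omega), Fin.sum_univ_castSucc]
  simp only [Fin.snoc_castSucc, Fin.snoc_last]
  congr 1
  by_cases ho : o ∈ A
  · have : visits A h < k := by simp [ho] at hk; omega
    simp [ho, this]
  · simp [ho]

/-- The constant is collected once per counted visit. In the exponential bound this turns the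
compensator `-λ² / 8` of each visit into exactly `k` times that amount once `k` visits have
occurred. -/
theorem cappedSum_affine (A : Set O) (w : O → ℝ) (a b : ℝ) (k : ℕ) {n : ℕ} (h : Fin n → O) :
    cappedSum A (fun o => a * w o + b) k n h =
      a * cappedSum A w k n h + b * (min (visits A h) k : ℕ) := by
  classical
  refine snoc_induction (P := fun n h => cappedSum A (fun o => a * w o + b) k n h =
      a * cappedSum A w k n h + b * (min (visits A h) k : ℕ)) (by simp) ?_ n h
  intro n h o ih
  rw [cappedSum_snoc, cappedSum_snoc, ih, visits_snoc]
  by_cases ho : o ∈ A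
  · by_cases hk : visits A h < k
    · have h1 : min (visits A h) k = visits A h := by omega
      have h2 : min (visits A h + 1) k = visits A h + 1 := by omega
      simp only [ho, hk, h1, h2, and_self, if_true]
      push_cast; ring
    · have h1 : min (visits A h) k = k := by omega
      have h2 : min (visits A h + 1) k = k := by omega
      simp [ho, hk, h1, h2]
  · simp [ho]

variable [MeasurableSpace O]

theorem measurable_visits {A : Set O} (hA : MeasurableSet A) (n : ℕ) :
    Measurable fun h : Fin n → O => visits A h := by
  classical
  refine Finset.measurable_sum _ fun t _ => ?_
  exact Measurable.ite (measurable_pi_apply t hA) measurable_const measurable_const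

theorem measurable_cappedSum {A : Set O} (hA : MeasurableSet A) {w : O → ℝ} (hw : Measurable w)
    (k n : ℕ) : Measurable fun h : Fin n → O => cappedSum A w k n h := by
  classical
  induction n with
  | zero => simp only [cappedSum_zero]; exact measurable_const
  | succ n ih =>
    have hi : Measurable fun h : Fin (n + 1) → O => (Fin.init h : Fin n → O) :=
      measurable_pi_lambda _ fun i => measurable_pi_apply _
    refine (ih.comp hi).add (Measurable.ite ?_ (hw.comp (measurable_pi_apply _)) measurable_const)
    exact (measurable_pi_apply (Fin.last n) hA).inter
      (measurableSet_lt ((measurable_visits hA n).comp hi) measurable_const)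

end Visits

/-! ### Hoeffding's inequality for adaptively collected sums. -/

section Exponential

variable {D O : Type*} [MeasurableSpace D] [MeasurableSpace O]

open Classical in
/-- Exponential supermartingale bound for weights collected at the first `k` visits to `A`. -/
theorem lintegral_exp_cappedSum_le (κ : Kernel D (D × O)) [IsMarkovKernel κ] (s₀ : D)
    {A : Set O} (hA : MeasurableSet A) {w : O → ℝ} (hw : Measurable w) (k : ℕ)
    (h : ∀ d, ∫⁻ q, (if q.2 ∈ A then ENNReal.ofReal (Real.exp (w q.2)) else 1) ∂κ d ≤ 1)
    (N : ℕ) :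
    ∫⁻ p, ENNReal.ofReal (Real.exp (cappedSum A w k N p.2)) ∂runLaw κ s₀ N ≤ 1 := by
  have hm : ∀ n, Measurable fun p : D × (Fin n → O) =>
      ENNReal.ofReal (Real.exp (cappedSum A w k n p.2)) := fun n =>
    ((measurable_cappedSum hA hw k n).comp measurable_snd).exp.ennreal_ofReal
  refine (lintegral_runLaw_le κ s₀ hm N ?_).trans (by simp)
  intro n _ d hh
  simp only [cappedSum_snoc, Real.exp_add, ENNReal.ofReal_mul (Real.exp_pos _).le]
  have hm2 : Measurable fun q : D × O =>
      ENNReal.ofReal (Real.exp (if q.2 ∈ A ∧ visits A hh < k then w q.2 else 0)) := by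
    refine (Measurable.ite ?_ (hw.comp measurable_snd) measurable_const).exp.ennreal_ofReal
    exact (measurable_snd hA).inter (MeasurableSet.const _)
  rw [lintegral_const_mul _ hm2]
  refine mul_le_of_le_one_right bot_le ?_
  by_cases hk : visits A hh < k
  · refine (lintegral_mono fun q => ?_).trans (h d)
    by_cases hq : q.2 ∈ A <;> simp [hq, hk]
  · simp [hk]

/-- Markov's inequality for the exponential supermartingale. Freezing the sum after the `k`-th visit
avoids a union bound over the random time of that visit. -/
theorem tail_cappedSum (κ : Kernel D (D × O)) [IsMarkovKernel κ] (s₀ : D)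
    {A : Set O} (hA : MeasurableSet A) {w : O → ℝ} (hw : Measurable w) (k : ℕ)
    (h : ∀ lam : ℝ, 0 ≤ lam → ∀ d, ∫⁻ q, (open Classical in if q.2 ∈ A then
      ENNReal.ofReal (Real.exp (lam * w q.2 + -(lam ^ 2 / 8))) else 1) ∂κ d ≤ 1)
    {ε : ℝ} (hε : 0 ≤ ε) (N : ℕ) :
    (runLaw κ s₀ N).real {p | k ≤ visits A p.2 ∧ k * ε ≤ cappedSum A w k N p.2} ≤
      Real.exp (-2 * k * ε ^ 2) := by
  -- The choice `λ = 4ε` maximizes `λε - λ² / 8`, whose value is then `2ε²` per visit.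
  have key := lintegral_exp_cappedSum_le κ s₀ hA
    (w := fun o => 4 * ε * w o + -((4 * ε) ^ 2 / 8)) ((hw.const_mul _).add_const _) k
    (h (4 * ε) (by positivity)) N
  have hm : Measurable fun p : D × (Fin N → O) => ENNReal.ofReal (Real.exp
      (cappedSum A (fun o => 4 * ε * w o + -((4 * ε) ^ 2 / 8)) k N p.2)) :=
    ((measurable_cappedSum hA ((hw.const_mul _).add_const _) k N).comp
      measurable_snd).exp.ennreal_ofReal
  have h2 : (runLaw κ s₀ N) {p | k ≤ visits A p.2 ∧ k * ε ≤ cappedSum A w k N p.2} ≤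
      ENNReal.ofReal (Real.exp (-2 * k * ε ^ 2)) := by
    have h3 := (mul_meas_ge_le_lintegral (μ := runLaw κ s₀ N) hm
      (ENNReal.ofReal (Real.exp (2 * k * ε ^ 2)))).trans key
    have h4 : {p : D × (Fin N → O) | k ≤ visits A p.2 ∧ k * ε ≤ cappedSum A w k N p.2} ⊆
        {p | ENNReal.ofReal (Real.exp (2 * k * ε ^ 2)) ≤ ENNReal.ofReal (Real.exp
          (cappedSum A (fun o => 4 * ε * w o + -((4 * ε) ^ 2 / 8)) k N p.2))} := by
      rintro p ⟨hp1, hp2⟩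
      refine ENNReal.ofReal_le_ofReal (Real.exp_le_exp.2 ?_)
      rw [cappedSum_affine, min_eq_right hp1]
      nlinarith
    have h5 := (mul_le_mul_right (measure_mono (μ := runLaw κ s₀ N) h4)
      (ENNReal.ofReal (Real.exp (2 * k * ε ^ 2)))).trans h3
    rw [show -2 * k * ε ^ 2 = -(2 * k * ε ^ 2) by ring, Real.exp_neg,
      ENNReal.ofReal_inv_of_pos (Real.exp_pos _)]
    rw [← one_div, ENNReal.le_div_iff_mul_le (by simp [Real.exp_pos]) (by simp), mul_comm]
    exact h5
  exact ENNReal.toReal_le_of_le_ofReal (Real.exp_pos _).le h2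

end Exponential

/-! ### Arms, gaps and the bandit game. -/

section Arms

variable {X : Type u} [MeasurableSpace X] {M : Type v} [MeasurableSpace M]

theorem integrable_utility (ν : Kernel X I) [IsMarkovKernel ν] (x : X) :
    Integrable (fun r : I => (r : ℝ)) (ν x) :=
  Integrable.of_bound (by fun_prop) 1 (Filter.Eventually.of_forall fun r => by
    rw [Real.norm_eq_abs, abs_of_nonneg r.2.1]; exact r.2.2)

theorem armMean_nonneg (ν : Kernel X I) (x : X) : 0 ≤ armMean ν x :=
  integral_nonneg fun r => r.2.1

theorem armMean_le_one (ν : Kernel X I) [IsMarkovKernel ν] (x : X) : armMean ν x ≤ 1 := by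
  refine (integral_mono (integrable_utility ν x) (integrable_const 1) fun r => r.2.2).trans ?_
  simp

theorem bddAbove_armMean (ν : Kernel X I) [IsMarkovKernel ν] :
    BddAbove (Set.range (armMean ν)) :=
  ⟨1, by rintro _ ⟨x, rfl⟩; exact armMean_le_one ν x⟩

theorem armGap_nonneg (ν : Kernel X I) [IsMarkovKernel ν] (x : X) : 0 ≤ armGap ν x :=
  sub_nonneg.2 (le_ciSup (bddAbove_armMean ν) x)

theorem iSup_armMean_le_one (ν : Kernel X I) [IsMarkovKernel ν] : ⨆ z, armMean ν z ≤ 1 :=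
  Real.iSup_le (armMean_le_one ν) zero_le_one

theorem armGap_le_one (ν : Kernel X I) [IsMarkovKernel ν] (x : X) : armGap ν x ≤ 1 := by
  have := armMean_nonneg ν x
  have := iSup_armMean_le_one ν
  unfold armGap; linarith

/-- Hoeffding's lemma for the utilities of an arm. -/
theorem lintegral_exp_utility_le (ν : Kernel X I) [IsMarkovKernel ν] (x : X) (c : ℝ) :
    ∫⁻ r, ENNReal.ofReal (Real.exp (c * ((r : ℝ) - armMean ν x) + -(c ^ 2 / 8))) ∂ν x ≤ 1 := by
  have hs := hasSubgaussianMGF_of_mem_Icc (μ := ν x) (X := fun r : I => (r : ℝ)) (a := 0) (b := 1)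
    (by fun_prop) (Filter.Eventually.of_forall fun r => r.2)
  have h1 := hs.mgf_le c
  have h2 := hs.integrable_exp_mul c
  simp only [Real.exp_add]
  change Integrable (fun r : I => Real.exp (c * ((r : ℝ) - armMean ν x))) (ν x) at h2
  rw [← ofReal_integral_eq_lintegral_ofReal (h2.mul_const _)
    (Filter.Eventually.of_forall fun r => by positivity), integral_mul_const]
  rw [← ENNReal.ofReal_one]
  refine ENNReal.ofReal_le_ofReal ?_
  unfold mgf at h1
  calc _ ≤ Real.exp (c ^ 2 / 8) * Real.exp (-(c ^ 2 / 8)) := by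
        refine mul_le_mul_of_nonneg_right (h1.trans (le_of_eq ?_)) (Real.exp_pos _).le
        congr 1; simp; ring
    _ = 1 := by rw [← Real.exp_add]; simp

instance mabLaw_isProbability (S : SBM X M) (ν : Kernel X I) [IsMarkovKernel ν] (T : ℕ) :
    IsProbabilityMeasure (S.mabLaw ν T) :=
  runLaw_isProbability _ _ _

theorem lintegral_mabStep (S : SBM X M) (ν : Kernel X I) [IsMarkovKernel ν] (m : M)
    {F : M × (X × I) → ENNReal} (hF : Measurable F) :
    ∫⁻ q, F q ∂S.mabStep ν m =
      ∫⁻ a, ∫⁻ r, F (S.feedback (a.1, r), (a.2, r)) ∂ν a.2 ∂S.advance m := by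
  have := S.measurable_feedback
  have hm : Measurable fun q : (M × X) × I => (S.feedback (q.1.1, q.2), (q.1.2, q.2)) := by
    fun_prop
  rw [SBM.mabStep, Kernel.lintegral_map _ hm _ hF]
  exact Kernel.lintegral_compProd _ _ _ (hF.comp hm)

theorem integral_mabStep (S : SBM X M) (ν : Kernel X I) [IsMarkovKernel ν] (m : M)
    {g : X × I → ℝ} (hg : Measurable g) {C : ℝ} (hC : ∀ o, |g o| ≤ C) :
    ∫ q, g q.2 ∂S.mabStep ν m = ∫ a, ∫ r, g (a.2, r) ∂ν a.2 ∂S.advance m := by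
  have := S.measurable_feedback
  have hm : Measurable fun q : (M × X) × I => (S.feedback (q.1.1, q.2), (q.1.2, q.2)) := by
    fun_prop
  have hg2 : Measurable fun q : M × (X × I) => g q.2 := hg.comp measurable_snd
  rw [SBM.mabStep, Kernel.map_apply _ hm, integral_map hm.aemeasurable hg2.aestronglyMeasurable,
    ProbabilityTheory.integral_compProd]
  · simp [Kernel.comap_apply]
  · exact Integrable.of_bound (hg2.comp hm).aestronglyMeasurable C
      (Filter.Eventually.of_forall fun p => hC _)

variable [DiscreteMeasurableSpace X]

theorem measurableSet_arm (z : X) : MeasurableSet {o : X × I | o.1 = z} :=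
  measurable_fst (MeasurableSet.of_discrete (s := {z}))

/-- Hoeffding's inequality for the first `k` utilities received from arm `z`. -/
theorem mab_tail (S : SBM X M) (ν : Kernel X I) [IsMarkovKernel ν] (T : ℕ) (z : X) (k : ℕ)
    {c : ℝ} (hc : c ^ 2 = 1) {ε : ℝ} (hε : 0 ≤ ε) :
    (S.mabLaw ν T).real {p | k ≤ visits {o | o.1 = z} p.2 ∧
      k * ε ≤ cappedSum {o | o.1 = z} (fun o : X × I => c * ((o.2 : ℝ) - armMean ν z)) k T p.2} ≤
      Real.exp (-2 * k * ε ^ 2) := by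
  classical
  refine tail_cappedSum _ _ (measurableSet_arm z) (by fun_prop) k ?_ hε T
  intro lam _ m
  rw [lintegral_mabStep]
  · refine (lintegral_mono (g := fun _ => 1) fun a => ?_).trans (by simp)
    by_cases ha : a.2 = z
    · have := lintegral_exp_utility_le ν z (lam * c)
      simp only [Set.mem_ofPred_eq, ha, if_true]
      rw [mul_pow, hc] at this
      simpa [mul_assoc] using this
    · simp [ha]
  · refine Measurable.ite ?_ (by fun_prop) measurable_const
    exact measurable_snd (measurableSet_arm z)

omit [MeasurableSpace X] [DiscreteMeasurableSpace X] in
theorem playCount_eq_visits {T : ℕ} (x : X) (h : Fin T → X × I) :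
    playCount x h = visits {o | o.1 = x} h := by
  classical
  rw [playCount, visits, Nat.card_eq_fintype_card, Fintype.card_subtype, Finset.card_filter]
  rfl

/-- The expected regret is the expected sum of gaps. -/
theorem mabRegret_eq [Finite X] (S : SBM X M) (ν : Kernel X I) [IsMarkovKernel ν] (T : ℕ) :
    S.mabRegret ν T = ∫ p, ∑ t, armGap ν (p.2 t).1 ∂S.mabLaw ν T := by
  have hmean : Measurable (armMean ν) := Measurable.of_discrete
  have hb : ∀ (r : I), |(r : ℝ)| ≤ 1 := fun r => by rw [abs_of_nonneg r.2.1]; exact r.2.2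
  have hb2 : ∀ x, |armMean ν x| ≤ 1 := fun x => by
    rw [abs_of_nonneg (armMean_nonneg ν x)]; exact armMean_le_one ν x
  have hb3 : |⨆ z, armMean ν z| ≤ 1 := by
    rw [abs_of_nonneg (Real.iSup_nonneg (armMean_nonneg ν))]; exact iSup_armMean_le_one ν
  -- Given the arm played, the utility is centered at the mean of that arm, so replacing utilities
  -- by means does not change the expectation.
  have h0 := integral_sum_runLaw_eq_zero (S.mabStep ν) S.reset
    (g := fun o : X × I => armMean ν o.1 - o.2) (by fun_prop) (C := 2)
    (fun o => (abs_sub _ _).trans (by linarith [hb o.2, hb2 o.1])) (fun m => by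
      rw [integral_mabStep _ _ _ (g := fun o : X × I => armMean ν o.1 - o.2)
        (by fun_prop) (C := 2)
        (fun o => (abs_sub _ _).trans (by linarith [hb o.2, hb2 o.1]))]
      refine integral_eq_zero_of_ae (Filter.Eventually.of_forall fun a => ?_)
      simp only
      rw [integral_sub (integrable_const _) (integrable_utility ν _)]
      simp [armMean]) T
  rw [SBM.mabRegret, ← sub_eq_zero, ← integral_sub]
  · rw [← h0]
    refine integral_congr_ae (Filter.Eventually.of_forall fun p => ?_)
    simp only [← Finset.sum_sub_distrib]
    refine Finset.sum_congr rfl fun t _ => ?_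
    unfold armGap; ring
  · refine Integrable.of_bound (Measurable.aestronglyMeasurable (by fun_prop)) (∑ _t : Fin T, 2)
      (Filter.Eventually.of_forall fun p => ?_)
    refine (Finset.abs_sum_le_sum_abs _ _).trans (Finset.sum_le_sum fun t _ => ?_)
    exact (abs_sub _ _).trans (by linarith [hb (p.2 t).2])
  · have : Measurable (armGap ν) := Measurable.of_discrete
    refine Integrable.of_bound (Measurable.aestronglyMeasurable (by fun_prop)) (∑ _t : Fin T, 2)
      (Filter.Eventually.of_forall fun p => ?_)
    refine (Finset.abs_sum_le_sum_abs _ _).trans (Finset.sum_le_sum fun t _ => ?_)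
    exact (abs_sub _ _).trans (by linarith [hb2 (p.2 t).1])

end Arms

/-! ### The confidence bounds of UCB and the invariant behind its play counts. -/

section UCB

variable {X : Type u} [Fintype X] [DecidableEq X] [Nonempty X] [MeasurableSpace X]
  [DiscreteMeasurableSpace X]

theorem ucb_advance (sel : Kernel (UCBState X) X) [IsMarkovKernel sel] (d : UCBState X × X) :
    (ucb sel).advance d = (sel d.1).map fun y => ((d.1, y), y) := by
  have hm : Measurable fun q : (UCBState X × X) × X => ((q.1.1, q.2), q.2) := by fun_prop
  change ((Kernel.id ×ₖ sel.comap Prod.fst measurable_fst).map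
    fun q : (UCBState X × X) × X => ((q.1.1, q.2), q.2)) d = _
  rw [Kernel.map_apply _ hm, Kernel.prod_apply, Kernel.id_apply, Kernel.comap_apply,
    Measure.dirac_prod, Measure.map_map hm measurable_prodMk_left]
  rfl

/-- Only the selected arm needs an almost sure statement; the invariant below is preserved whatever
utility is then received. -/
theorem ae_ucb_mabStep (sel : Kernel (UCBState X) X) [IsMarkovKernel sel] (ν : Kernel X I)
    [IsMarkovKernel ν] (d : UCBState X × X) {P : (UCBState X × X) × (X × I) → Prop}
    (hP : MeasurableSet {q | P q})
    (h : ∀ᵐ y ∂sel d.1, ∀ r, P ((ucb sel).feedback ((d.1, y), r), (y, r))) :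
    ∀ᵐ q ∂(ucb sel).mabStep ν d, P q := by
  have hm : Measurable ({q | P q}ᶜ.indicator (1 : (UCBState X × X) × (X × I) → ENNReal)) :=
    measurable_one.indicator hP.compl
  have hf := (ucb sel).measurable_feedback
  have h1 := lintegral_mabStep (ucb sel) ν d hm
  rw [lintegral_indicator_one hP.compl, ucb_advance, lintegral_map] at h1
  · refine h1.trans ((lintegral_congr_ae (g := fun _ => 0) ?_).trans (by simp))
    filter_upwards [h] with y hy
    simp [hy]
  · have h2 : Measurable fun p : ((UCBState X × X) × X) × I =>
        {q | P q}ᶜ.indicator (1 : (UCBState X × X) × (X × I) → ENNReal)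
          ((ucb sel).feedback (p.1.1, p.2), (p.1.2, p.2)) :=
      hm.comp ((hf.comp (by fun_prop)).prodMk (by fun_prop))
    exact Measurable.lintegral_kernel_prod_right (κ := ν.comap (fun p : (UCBState X × X) × X => p.2)
      measurable_snd) h2
  · fun_prop

/-- The confidence radius of UCB in round `t` after `k` plays. -/
def ucbRadius (α : ℝ) (t k : ℕ) : ℝ := √((α + 2) * Real.log t / (2 * k))

theorem ucbRadius_nonneg (α : ℝ) (t k : ℕ) : 0 ≤ ucbRadius α t k := Real.sqrt_nonneg _

theorem ucbRadius_mono {α : ℝ} (hα : 0 ≤ α) {s t : ℕ} (hs : 1 ≤ s) (hst : s ≤ t) (k : ℕ) :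
    ucbRadius α s k ≤ ucbRadius α t k := by
  refine Real.sqrt_le_sqrt ?_
  have : Real.log s ≤ Real.log t :=
    Real.log_le_log (by exact_mod_cast hs) (by exact_mod_cast hst)
  gcongr

/-- After its `n`-th play, the record shows that the utilities of `x` deviate upwards. -/
def DeviatesUp (ν : Kernel X I) (x : X) (n : ℕ) (ε : ℝ) {N : ℕ} (h : Fin N → X × I) : Prop :=
  n ≤ visits {o | o.1 = x} h ∧
    n * ε ≤ cappedSum {o | o.1 = x} (fun o : X × I => 1 * ((o.2 : ℝ) - armMean ν x)) n N h

/-- After its `n`-th play, the record shows that the utilities of `x` deviate downwards. -/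
def DeviatesDown (ν : Kernel X I) (x : X) (n : ℕ) (ε : ℝ) {N : ℕ} (h : Fin N → X × I) : Prop :=
  n ≤ visits {o | o.1 = x} h ∧
    n * ε ≤ cappedSum {o | o.1 = x} (fun o : X × I => -1 * ((o.2 : ℝ) - armMean ν x)) n N h

omit [Fintype X] [DecidableEq X] [Nonempty X] in
theorem measurable_deviates (ν : Kernel X I) (x : X) (n : ℕ) (ε c : ℝ) (N : ℕ) :
    Measurable fun h : Fin N → X × I => n ≤ visits {o | o.1 = x} h ∧
      n * ε ≤ cappedSum {o | o.1 = x} (fun o : X × I => c * ((o.2 : ℝ) - armMean ν x)) n N h := by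
  refine Measurable.and ?_ ?_
  · exact measurableSet_setOfPred.1
      (measurableSet_le measurable_const (measurable_visits (measurableSet_arm x) N))
  · exact measurableSet_setOfPred.1 (measurableSet_le measurable_const
      (measurable_cappedSum (measurableSet_arm x) (by fun_prop) n N))

-- The cap is already reached, so a deviation event, once it has occurred, persists as the record
-- grows.
omit [Fintype X] [DecidableEq X] [Nonempty X] [MeasurableSpace X] [DiscreteMeasurableSpace X] in
theorem cappedSum_snoc_of_le (A : Set (X × I)) (w : X × I → ℝ) (k : ℕ) {n : ℕ}
    (h : Fin n → X × I) (o : X × I) (hk : k ≤ visits A h) :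
    cappedSum A w k (n + 1) (Fin.snoc h o) = cappedSum A w k n h := by
  rw [cappedSum_snoc, if_neg (by omega), add_zero]

/-- The sum of the utilities received from arm `x`. -/
def utilitySum (x : X) {N : ℕ} (h : Fin N → X × I) : ℝ :=
  ∑ t, if (h t).1 = x then ((h t).2 : ℝ) else 0

omit [Fintype X] [Nonempty X] [MeasurableSpace X] [DiscreteMeasurableSpace X] in
theorem cappedSum_eq_utilitySum (c a : ℝ) (x : X) {N : ℕ} (h : Fin N → X × I) (k : ℕ)
    (hk : visits {o | o.1 = x} h = k) :
    cappedSum {o | o.1 = x} (fun o : X × I => c * ((o.2 : ℝ) - a)) k N h =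
      c * (utilitySum x h - k * a) := by
  have h1 := cappedSum_affine {o : X × I | o.1 = x} (fun o => (o.2 : ℝ)) c (-(c * a)) k h
  rw [cappedSum_eq_sum _ (fun o : X × I => (o.2 : ℝ)) _ _ hk.le, hk, min_self] at h1
  rw [show (fun o : X × I => c * ((o.2 : ℝ) - a)) = fun o : X × I => c * (o.2 : ℝ) + -(c * a) by
    ext o; ring, h1]
  simp only [utilitySum, Set.mem_ofPred_eq]
  have : ∀ t, (@ite ℝ ((h t).1 = x) (Classical.propDecidable _) ((h t).2 : ℝ) 0) =
      if (h t).1 = x then ((h t).2 : ℝ) else 0 := fun t => by congr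
  simp only [this]
  ring

/-- The state of UCB reflects the record, and an arm `x` is played more than `n` times only if
some confidence bound has failed. -/
def UCBInvariant (α : ℝ) (ν : Kernel X I) (xs x : X) (T n N : ℕ)
    (p : (UCBState X × X) × (Fin N → X × I)) : Prop :=
  p.1.1.1 = N + 1 ∧ (∀ z, p.1.1.2.1 z = visits {o | o.1 = z} p.2) ∧
    (∀ z, p.1.1.2.2 z = utilitySum z p.2) ∧
    (n < visits {o | o.1 = x} p.2 → N ≤ T →
      DeviatesUp ν x n (armGap ν x / 2) p.2 ∨
        ∃ t, (n + 1 ≤ t ∧ t ≤ N) ∧ ∃ k, (1 ≤ k ∧ k ≤ t - 1) ∧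
          DeviatesDown ν xs k (ucbRadius α t k) p.2)

omit [Nonempty X] in
theorem measurableSet_ucbInvariant (α : ℝ) (ν : Kernel X I) (xs x : X) (T n N : ℕ) :
    MeasurableSet {p | UCBInvariant α ν xs x T n N p} := by
  have hv : ∀ z, Measurable fun p : (UCBState X × X) × (Fin N → X × I) =>
      visits {o | o.1 = z} p.2 := fun z =>
    (measurable_visits (measurableSet_arm z) N).comp measurable_snd
  refine measurableSet_setOfPred.2 (Measurable.and ?_ (Measurable.and ?_ (Measurable.and ?_
    (Measurable.imp ?_ (Measurable.imp measurable_const (Measurable.or ?_ (Measurable.exists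
      fun t => Measurable.and measurable_const (Measurable.exists fun k =>
        Measurable.and measurable_const ?_))))))))
  · exact measurableSet_setOfPred.1 (measurableSet_eq_fun (by fun_prop) measurable_const)
  · exact Measurable.forall fun z =>
      measurableSet_setOfPred.1 (measurableSet_eq_fun (by fun_prop) (hv z))
  · refine Measurable.forall fun z =>
      measurableSet_setOfPred.1 (measurableSet_eq_fun (by fun_prop) ?_)
    refine Finset.measurable_sum _ fun t _ => Measurable.ite ?_ (by fun_prop) measurable_const
    exact ((measurable_pi_apply t).comp measurable_snd :
      Measurable fun p : (UCBState X × X) × (Fin N → X × I) => p.2 t) (measurableSet_arm z)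
  · exact measurableSet_setOfPred.1 (measurableSet_lt measurable_const (hv x))
  · exact (measurable_deviates ν x n _ 1 N).comp measurable_snd
  · exact (measurable_deviates ν xs k _ (-1) N).comp measurable_snd

/-- The combinatorial core of UCB. All the probability is deferred: the selection rule makes an
excess play of `x` imply, almost surely, one of finitely many deviations at deterministic sample
sizes. -/
theorem ae_ucbInvariant {α : ℝ} (hα : 0 ≤ α) {sel : Kernel (UCBState X) X} [IsMarkovKernel sel]
    (hsel : IsUCBSelection α sel) (ν : Kernel X I) [IsMarkovKernel ν] {xs x : X}
    (hxs : armMean ν xs = ⨆ z, armMean ν z) {T n : ℕ} (hn : 1 ≤ n)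
    (hrad : ucbRadius α T n ≤ armGap ν x / 2) (N : ℕ) :
    ∀ᵐ p ∂(ucb sel).mabLaw ν N, UCBInvariant α ν xs x T n N p := by
  refine ae_runLaw _ _ (measurableSet_ucbInvariant α ν xs x T n) ?_ ?_ N
  · refine ⟨rfl, fun z => ?_, fun z => ?_, ?_⟩
    · simp [ucb]
    · simp [ucb, utilitySum]
    · simp
  rintro N d h ⟨h1, h2, h3, h4⟩
  simp only at h1 h2 h3 h4
  refine ae_ucb_mabStep sel ν d ?_ ?_
  · exact ((measurable_snoc_aux N).comp (measurable_prodMk_left (x := (d, h))))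
      (measurableSet_ucbInvariant α ν xs x T n (N + 1))
  filter_upwards [hsel d.1] with y hy r
  refine ⟨?_, fun z => ?_, fun z => ?_, ?_⟩
  · simp [ucb] at h1 ⊢; exact h1
  · simp only [ucb, visits_snoc, Function.update_apply, h2, Set.mem_ofPred_eq]
    by_cases hz : z = y
    · simp [hz]
    · simp [hz, Ne.symm hz]
  · rw [utilitySum]
    simp only [ucb, Function.update_apply, h3, Fin.sum_univ_castSucc,
      Fin.snoc_castSucc, Fin.snoc_last]
    by_cases hz : z = y
    · simp [hz, utilitySum]
    · simp [hz, Ne.symm hz, utilitySum]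
  · intro hv hNT
    simp only at hv
    have hup : ∀ {z : X} {k : ℕ} {ε c : ℝ}, (k ≤ visits {o | o.1 = z} h ∧ k * ε ≤
        cappedSum {o | o.1 = z} (fun o : X × I => c * ((o.2 : ℝ) - armMean ν z)) k N h) →
        (k ≤ visits {o | o.1 = z} (Fin.snoc h (y, r) : Fin (N + 1) → X × I) ∧ k * ε ≤
        cappedSum {o | o.1 = z} (fun o : X × I => c * ((o.2 : ℝ) - armMean ν z)) k (N + 1)
          (Fin.snoc h (y, r))) := by
      rintro z k ε c ⟨ha, hb⟩
      rw [cappedSum_snoc_of_le _ _ _ _ _ ha, visits_snoc]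
      exact ⟨by omega, hb⟩
    by_cases hx : n < visits {o | o.1 = x} h
    · rcases h4 hx (by omega) with hd | ⟨t, ht, k, hk, hd⟩
      · exact Or.inl (hup hd)
      · exact Or.inr ⟨t, ⟨ht.1, by omega⟩, k, hk, hup hd⟩
    -- The count passes `n` in this very round, so the selected arm is `x`, with exactly `n` earlier
    -- plays.
    · rw [visits_snoc] at hv
      have hyx : y = x := by
        by_contra hne
        simp [hne] at hv
        omega
      subst hyx
      have hvn : visits {o | o.1 = y} h = n := by simp at hv; omega
      have hidx := hy xs
      have hvN := visits_le {o : X × I | o.1 = y} h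
      have hvs := visits_le {o : X × I | o.1 = xs} h
      set k := visits {o : X × I | o.1 = xs} h with hkdef
      -- An unplayed best arm would have index `⊤`, whereas the index of the selected arm is finite
      -- since `n ≥ 1`.
      have hk1 : 1 ≤ k := by
        by_contra hk0
        have : d.1.2.1 xs = 0 := by rw [h2 xs]; omega
        have h5 : d.1.2.1 y ≠ 0 := by rw [h2 y]; omega
        simp only [ucbIndex, this, h5, if_true, if_false, top_le_iff] at hidx
        exact EReal.coe_ne_top _ hidx
      have hix : utilitySum xs h / k + ucbRadius α (N + 1) k ≤
          utilitySum y h / n + ucbRadius α (N + 1) n := by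
        have h5 : d.1.2.1 y ≠ 0 := by rw [h2 y]; omega
        have h6 : d.1.2.1 xs ≠ 0 := by rw [h2 xs]; omega
        simp only [ucbIndex, h5, h6, if_false] at hidx
        rw [EReal.coe_le_coe_iff, h2, h2, h3, h3, h1, hvn, ← hkdef] at hidx
        exact hidx
      have hkpos : (0 : ℝ) < k := by exact_mod_cast hk1
      have hnpos : (0 : ℝ) < n := by exact_mod_cast hn
      have hmono := ucbRadius_mono hα (show 1 ≤ N + 1 by omega) hNT n
      have hgap : armGap ν y = armMean ν xs - armMean ν y := by rw [armGap, hxs]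
      -- Either the best arm is underestimated at round `N + 1`, or the index of `y` exceeds the
      -- best mean; its radius is at most half the gap, so its average is then at least half a gap
      -- too high.
      by_cases hlow : utilitySum xs h / k + ucbRadius α (N + 1) k ≤ armMean ν xs
      · refine Or.inr ⟨N + 1, ⟨by omega, le_rfl⟩, k, ⟨hk1, by omega⟩, hup ⟨le_rfl, ?_⟩⟩
        rw [cappedSum_eq_utilitySum _ _ _ _ _ rfl]
        have h7 : utilitySum xs h / k ≤ armMean ν xs - ucbRadius α (N + 1) k := by linarith
        rw [div_le_iff₀ hkpos] at h7
        rw [← hkdef]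
        linarith
      · refine Or.inl (hup ⟨hvn.ge, ?_⟩)
        rw [cappedSum_eq_utilitySum _ _ _ _ _ hvn]
        have h7 : armMean ν y + armGap ν y / 2 ≤ utilitySum y h / n := by linarith
        rw [le_div_iff₀ hnpos] at h7
        linarith

end UCB

/-! ### Summing the deviation probabilities; robustness of UCB. -/

theorem rpow_neg_succ_le {α : ℝ} (hα : 1 ≤ α) {t : ℝ} (ht : 0 < t) :
    (t + 1) ^ (-(α + 1)) ≤ (t ^ (-α) - (t + 1) ^ (-α)) / α := by
  -- Bernoulli's inequality replaces the comparison of `x ^ (-(α + 1))` with its integral, in a form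
  -- that telescopes.
  have h1 : 1 + α * (1 / t) ≤ (1 + 1 / t) ^ α :=
    one_add_mul_self_le_rpow_one_add (by linarith [show 0 < 1 / t by positivity]) hα
  have h2 : (t + 1) ^ (-α) * (1 + 1 / t) ^ α = t ^ (-α) := by
    rw [show 1 + 1 / t = (t + 1) / t by field_simp, Real.div_rpow (by positivity) ht.le,
      Real.rpow_neg (by positivity), Real.rpow_neg ht.le]
    field_simp
  have h3 : (t + 1) ^ (-(α + 1)) = (t + 1) ^ (-α) * (1 / (t + 1)) := by
    rw [neg_add, Real.rpow_add (by positivity), Real.rpow_neg_one, one_div]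
  have h4 : 1 / (t + 1) ≤ 1 / t := one_div_le_one_div_of_le ht (by linarith)
  have hp : 0 < (t + 1) ^ (-α) := by positivity
  rw [le_div_iff₀ (by linarith), h3, ← h2]
  have h5 : (t + 1) ^ (-α) * (1 + α * (1 / (t + 1))) ≤ (t + 1) ^ (-α) * (1 + 1 / t) ^ α := by
    refine mul_le_mul_of_nonneg_left (le_trans ?_ h1) hp.le
    nlinarith
  linarith

theorem sum_rpow_neg_succ_le {α : ℝ} (hα : 1 ≤ α) {n : ℕ} (hn : 1 ≤ n) (T : ℕ) :
    ∑ t ∈ Finset.Ioc n T, (t : ℝ) ^ (-(α + 1)) ≤ (n : ℝ) ^ (-α) / α := by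
  rcases le_total T n with hT | hT
  · rw [Finset.Ioc_eq_empty (by omega)]
    simp only [Finset.sum_empty]
    positivity
  suffices h : ∑ t ∈ Finset.Ioc n T, (t : ℝ) ^ (-(α + 1)) ≤
      ((n : ℝ) ^ (-α) - (T : ℝ) ^ (-α)) / α by
    refine h.trans ?_
    gcongr
    linarith [show 0 ≤ (T : ℝ) ^ (-α) by positivity]
  induction T, hT using Nat.le_induction with
  | base => simp
  | succ T hT ih =>
    rw [Finset.sum_Ioc_succ_top (by omega)]
    have := rpow_neg_succ_le hα (t := T) (by exact_mod_cast (show 0 < T by omega))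
    push_cast
    calc _ ≤ ((n : ℝ) ^ (-α) - (T : ℝ) ^ (-α)) / α +
          ((T : ℝ) ^ (-α) - (T + 1 : ℝ) ^ (-α)) / α := add_le_add ih this
      _ = _ := by ring

section UCB

variable {X : Type u} [Fintype X] [DecidableEq X] [Nonempty X] [MeasurableSpace X]
  [DiscreteMeasurableSpace X]

/-- The radius is designed so that the Hoeffding bound does not depend on `k`. Of the exponent `α +
2`, one unit pays for the union over `k` and one for the sum over `t`. -/
theorem exp_neg_two_mul_sq_ucbRadius {α : ℝ} (hα : 0 ≤ α) {t k : ℕ} (ht : 1 ≤ t) (hk : 1 ≤ k) :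
    Real.exp (-2 * k * ucbRadius α t k ^ 2) = (t : ℝ) ^ (-(α + 2)) := by
  have hk' : (0 : ℝ) < k := by exact_mod_cast hk
  have ht' : (1 : ℝ) ≤ t := by exact_mod_cast ht
  have := Real.log_nonneg ht'
  rw [ucbRadius, Real.sq_sqrt (by positivity), Real.rpow_def_of_pos (by linarith)]
  congr 1
  field_simp

theorem sum_exp_ucbRadius_le {α : ℝ} (hα : 1 ≤ α) {n : ℕ} (hn : 1 ≤ n) (T : ℕ) :
    ∑ t ∈ Finset.Ioc n T, ∑ k ∈ Finset.Icc 1 (t - 1),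
      Real.exp (-2 * k * ucbRadius α t k ^ 2) ≤ (n : ℝ) ^ (-α) / α := by
  refine (Finset.sum_le_sum fun t ht => ?_).trans (sum_rpow_neg_succ_le hα hn T)
  rw [Finset.mem_Ioc] at ht
  have ht' : (0 : ℝ) < t := by exact_mod_cast (show 0 < t by omega)
  calc _ = ∑ k ∈ Finset.Icc 1 (t - 1), (t : ℝ) ^ (-(α + 2)) :=
        Finset.sum_congr rfl fun k hk => exp_neg_two_mul_sq_ucbRadius (by linarith) (by omega)
          (Finset.mem_Icc.1 hk).1
    _ = ((t - 1 : ℕ) : ℝ) * (t : ℝ) ^ (-(α + 2)) := by simp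
    _ ≤ t * (t : ℝ) ^ (-(α + 2)) := by
        gcongr
        omega
    _ = (t : ℝ) ^ (-(α + 1)) := by
        rw [show -(α + 1) = 1 + -(α + 2) by ring, Real.rpow_add ht', Real.rpow_one]

/-- The first term is the single upward deviation of `x` after `n` plays, which is at least the
radius in size; the second collects all downward deviations of a best arm. -/
theorem ucb_tail {α : ℝ} (hα : 1 ≤ α) {sel : Kernel (UCBState X) X} [IsMarkovKernel sel]
    (hsel : IsUCBSelection α sel) (ν : Kernel X I) [IsMarkovKernel ν] (x : X) {T n : ℕ}
    (hn : 1 ≤ n) (hT : 1 ≤ T) (hrad : ucbRadius α T n ≤ armGap ν x / 2) :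
    ((ucb sel).mabLaw ν T).real {p | n < playCount x p.2} ≤
      (T : ℝ) ^ (-(α + 2)) + (n : ℝ) ^ (-α) / α := by
  obtain ⟨xs, hxs⟩ := exists_eq_ciSup_of_finite (f := armMean ν)
  have hinv := ae_ucbInvariant (by linarith) hsel ν hxs (x := x) hn hrad T
  set P := (ucb sel).mabLaw ν T
  have hsub : {p : (UCBState X × X) × (Fin T → X × I) | n < playCount x p.2} ≤ᵐ[P]
      ({p | DeviatesUp ν x n (armGap ν x / 2) p.2} ∪
        ⋃ t ∈ Finset.Ioc n T, ⋃ k ∈ Finset.Icc 1 (t - 1),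
          {p | DeviatesDown ν xs k (ucbRadius α t k) p.2} : Set _) := by
    filter_upwards [hinv] with p hp hpx
    change n < playCount x p.2 at hpx
    rw [playCount_eq_visits] at hpx
    rcases hp.2.2.2 hpx le_rfl with h | ⟨t, ht, k, hk, h⟩
    · exact Or.inl h
    · refine Or.inr ?_
      simp only [Set.mem_iUnion]
      exact ⟨t, Finset.mem_Ioc.2 ⟨by omega, ht.2⟩, k, Finset.mem_Icc.2 hk, h⟩
  have h0 := armGap_nonneg ν x
  refine (ENNReal.toReal_mono (measure_ne_top _ _) (measure_mono_ae hsub)).trans ?_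
  refine (measureReal_union_le _ _).trans (add_le_add ?_ ?_)
  · refine (mab_tail (ucb sel) ν T x n (by norm_num) (by positivity)).trans ?_
    rw [← exp_neg_two_mul_sq_ucbRadius (by linarith) hT hn, Real.exp_le_exp]
    have := pow_le_pow_left₀ (ucbRadius_nonneg α T n) hrad 2
    have hn' : (0 : ℝ) ≤ n := by positivity
    nlinarith
  · refine (measureReal_biUnion_finset_le _ _).trans ?_
    refine (Finset.sum_le_sum fun t _ => ?_).trans (sum_exp_ucbRadius_le hα hn T)
    refine (measureReal_biUnion_finset_le _ _).trans ?_
    exact Finset.sum_le_sum fun k _ =>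
      mab_tail (ucb sel) ν T xs k (by norm_num) (ucbRadius_nonneg _ _ _)

theorem one_add_le_two_rpow {α : ℝ} (hα : 1 ≤ α) : 1 + α ≤ (2 : ℝ) ^ α := by
  have := one_add_mul_self_le_rpow_one_add (s := 1) (by norm_num) hα
  norm_num at this
  exact this

/-- For `s < 1` the claimed bound exceeds `1`, and for `s ≥ T` the event is empty. Otherwise
`ucb_tail` applies with `n = ⌊s⌋`, and each of its two terms accounts for half of `2 / α`. -/
theorem ucb_isRobust {α : ℝ} (hα : 3 ≤ α) {sel : Kernel (UCBState X) X} [IsMarkovKernel sel]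
    (hsel : IsUCBSelection α sel) : (ucb sel).IsRobust α := by
  intro ν _ T x hgap s hs hsT
  have h2α := one_add_le_two_rpow (show 1 ≤ α by linarith)
  have hα0 : 0 < α := by linarith
  rcases lt_or_ge s 1 with hs1 | hs1
  · refine measureReal_le_one.trans_lt ?_
    have h1 : (2 : ℝ) ^ α ≤ (s / 2) ^ (-α) := by
      rw [Real.rpow_neg (by positivity), ← Real.inv_rpow (by positivity)]
      refine Real.rpow_le_rpow (by norm_num) ?_ hα0.le
      rw [inv_div, le_div_iff₀ hs]; linarith
    calc (1 : ℝ) < 2 / α * (1 + α) := by rw [div_mul_eq_mul_div, lt_div_iff₀ hα0]; linarith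
      _ ≤ _ := by gcongr; linarith
  rcases le_or_gt (T : ℝ) s with hTs | hTs
  · have : {p : (UCBState X × X) × (Fin T → X × I) | s < (playCount x p.2 : ℝ)} = ∅ := by
      refine Set.eq_empty_of_forall_notMem fun p hp => ?_
      have h1 : s < (playCount x p.2 : ℝ) := hp
      have h2 : (playCount x p.2 : ℝ) ≤ T := by
        rw [playCount_eq_visits]; exact_mod_cast visits_le _ _
      linarith
    rw [this, measureReal_empty]
    positivity
  have hT2 : 2 ≤ T := by
    have : (1 : ℝ) < T := by linarith
    exact_mod_cast this
  have hlog : 0.69 ≤ Real.log T := by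
    have := Real.log_le_log (by norm_num) (show (2 : ℝ) ≤ T by exact_mod_cast hT2)
    linarith [Real.log_two_gt_d9]
  have hgap1 := armGap_le_one ν x
  have hg2 : armGap ν x ^ 2 ≤ 1 := pow_le_one₀ hgap.le hgap1
  have hg2' : 0 < armGap ν x ^ 2 := by positivity
  have hsT' : 4 * α * Real.log T ≤ s * armGap ν x ^ 2 := by
    rwa [div_mul_eq_mul_div, div_le_iff₀ hg2'] at hsT
  have hs8 : 6 ≤ s := by nlinarith
  set n := ⌊s⌋₊ with hn
  have hns : (n : ℝ) ≤ s := Nat.floor_le hs.le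
  have hsn : s < n + 1 := Nat.lt_floor_add_one s
  have hn1 : 1 ≤ n := Nat.le_floor (by exact_mod_cast hs1)
  have hn5 : 5 / 6 * s ≤ n := by linarith
  have hnpos : (0 : ℝ) < n := by linarith
  -- With `n ≥ 5s / 6` and `s Δ² ≥ 4α ln T`, this amounts to `α + 2 ≤ 5α / 3`, that is, `α ≥ 3`.
  have hrad : ucbRadius α T n ≤ armGap ν x / 2 := by
    refine Real.sqrt_le_iff.2 ⟨by positivity, ?_⟩
    rw [div_le_iff₀ (by positivity)]
    nlinarith
  refine (le_of_eq_of_le ?_ (ucb_tail (by linarith) hsel ν x hn1 (by omega) hrad)).trans_lt ?_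
  · congr 1
    ext p
    exact (Nat.floor_lt hs.le).symm
  have hs2 : 0 < (s / 2) ^ (-α) := by positivity
  have h1 : (n : ℝ) ^ (-α) < (s / 2) ^ (-α) :=
    Real.rpow_lt_rpow_of_neg (by positivity) (by linarith) (by linarith)
  have h2 : (T : ℝ) ^ (-(α + 2)) ≤ (s / 2) ^ (-α) / α := by
    calc (T : ℝ) ^ (-(α + 2)) ≤ (T : ℝ) ^ (-α) :=
          Real.rpow_le_rpow_of_exponent_le (by linarith) (by linarith)
      _ ≤ s ^ (-α) := Real.rpow_le_rpow_of_nonpos hs hTs.le (by linarith)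
      _ = (s / 2) ^ (-α) / 2 ^ α := by
          rw [Real.div_rpow hs.le (by norm_num), Real.rpow_neg (x := 2) (by norm_num)]
          field_simp
      _ ≤ _ := by gcongr; linarith
  calc _ < (s / 2) ^ (-α) / α + (s / 2) ^ (-α) / α := by
        refine add_lt_add_of_le_of_lt h2 ?_
        gcongr
    _ = _ := by ring

end UCB

/-! ### The value function of a machine's future play counts. -/

section TailValue

variable {X : Type u} [DecidableEq X] [MeasurableSpace X] [DiscreteMeasurableSpace X]
  {M : Type v} [MeasurableSpace M]

/-- The probability that, playing `j` more rounds from memory `p.1`, the count `p.2` of plays of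
`y` ends up above `s`. -/
def tailValue (S : SBM X M) (ν : Kernel X I) (y : X) (s : ℝ) : ℕ → M × ℝ → ENNReal
  | 0, p => if s < p.2 then 1 else 0
  | j + 1, p => ∫⁻ q, tailValue S ν y s j (q.1, p.2 + if q.2.1 = y then 1 else 0) ∂S.mabStep ν p.1

omit [DecidableEq X] in
theorem measurableSet_arm_eq {E : Type*} [MeasurableSpace E]
    {f : E → X} (hf : Measurable f) (y : X) : MeasurableSet {e | f e = y} :=
  hf (MeasurableSet.of_discrete (s := {y}))

theorem measurable_indicator_arm {E : Type*} [MeasurableSpace E] {f : E → X} (hf : Measurable f)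
    (y : X) : Measurable fun e => if f e = y then (1 : ℝ) else 0 :=
  Measurable.ite (measurableSet_arm_eq hf y) measurable_const measurable_const

theorem measurable_tailValue (S : SBM X M) (ν : Kernel X I) [IsMarkovKernel ν] (y : X) (s : ℝ)
    (j : ℕ) : Measurable (tailValue S ν y s j) := by
  induction j with
  | zero =>
    exact Measurable.ite (measurableSet_lt measurable_const measurable_snd) measurable_const
      measurable_const
  | succ j ih =>
    have h2 : Measurable fun p : (M × ℝ) × (M × (X × I)) =>
        tailValue S ν y s j (p.2.1, p.1.2 + if p.2.2.1 = y then 1 else 0) :=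
      ih.comp ((by fun_prop : Measurable fun p : (M × ℝ) × (M × (X × I)) => p.2.1).prodMk
        ((by fun_prop : Measurable fun p : (M × ℝ) × (M × (X × I)) => p.1.2).add
          (measurable_indicator_arm (by fun_prop) y)))
    exact Measurable.lintegral_kernel_prod_right
      (κ := (S.mabStep ν).comap (fun p : M × ℝ => p.1) measurable_fst) h2

omit [DiscreteMeasurableSpace X] in
-- Counts never decrease, so a threshold already passed stays passed. This covers games that end
-- before the machine has used all its `B` calls.
theorem one_le_tailValue (S : SBM X M) (ν : Kernel X I) [IsMarkovKernel ν] (y : X) {s : ℝ}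
    (j : ℕ) {m : M} {c : ℝ} (hc : s < c) : 1 ≤ tailValue S ν y s j (m, c) := by
  induction j generalizing m c with
  | zero => simp [tailValue, hc]
  | succ j ih =>
    refine le_trans (by simp) (lintegral_mono (μ := S.mabStep ν m) (f := fun _ => 1) fun q => ?_)
    refine ih (hc.trans_le ?_)
    split_ifs <;> simp

/-- Along a standalone run the value with `B - n` rounds left is preserved on average, and at `n =
B` it is the indicator of the event. -/
theorem tailValue_le (S : SBM X M) (ν : Kernel X I) [IsMarkovKernel ν] (y : X) (s : ℝ) (B : ℕ) :
    tailValue S ν y s B (S.reset, 0) ≤ S.mabLaw ν B {p | s < (playCount y p.2 : ℝ)} := by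
  have hv : ∀ n, Measurable fun p : M × (Fin n → X × I) => (visits {o | o.1 = y} p.2 : ℝ) :=
    fun n => measurable_from_top.comp
      ((measurable_visits (measurableSet_arm y) n).comp measurable_snd)
  obtain ⟨W, hW⟩ : ∃ W, W = tailValue S ν y s := ⟨_, rfl⟩
  have hW0 : ∀ p, W 0 p = if s < p.2 then 1 else 0 := fun p => by rw [hW]; rfl
  have hWs : ∀ j p, W (j + 1) p =
      ∫⁻ q, W j (q.1, p.2 + if q.2.1 = y then 1 else 0) ∂S.mabStep ν p.1 :=
    fun j p => by rw [hW]; rfl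
  have hWm : ∀ j, Measurable (W j) := fun j => by
    rw [hW]; exact measurable_tailValue S ν y s j
  have hstep : ∀ n < B, ∀ m (h : Fin n → X × I),
      W (B - n) (m, (visits {o | o.1 = y} h : ℝ)) ≤
        ∫⁻ q, W (B - (n + 1)) (q.1, (visits {o | o.1 = y}
          (Fin.snoc h q.2 : Fin (n + 1) → X × I) : ℝ)) ∂S.mabStep ν m := by
    intro n hn m h
    rw [show B - n = B - (n + 1) + 1 by omega, hWs]
    refine le_of_eq (lintegral_congr fun q => ?_)
    rw [visits_snoc]
    by_cases hq : q.2.1 = y <;> simp [hq]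
  have hF : ∀ n, Measurable fun p : M × (Fin n → X × I) =>
      W (B - n) (p.1, (visits {o | o.1 = y} p.2 : ℝ)) :=
    fun n => (hWm _).comp (measurable_fst.prodMk (hv n))
  have h := lintegral_runLaw_ge (S.mabStep ν) S.reset hF B hstep
  simp only [Nat.sub_self, Nat.sub_zero, visits_zero, Nat.cast_zero] at h
  rw [← hW]
  refine h.trans (le_of_eq ?_)
  have hs : MeasurableSet {p : M × (Fin B → X × I) | s < (visits {o | o.1 = y} p.2 : ℝ)} :=
    measurableSet_lt measurable_const (hv B)
  simp only [playCount_eq_visits]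
  rw [← lintegral_indicator_one hs]
  refine lintegral_congr fun p => ?_
  simp only [hW0, Set.indicator, Set.mem_ofPred_eq, Pi.one_apply]

end TailValue

/-! ### The bandit environment induced by duels against a fixed left arm. -/

section Duel

variable {X : Type u} [MeasurableSpace X]

/-- The feedback `0` or `1` given to a machine after a duel. -/
def choiceReward (q : (I × I) × Bool) : I := bif q.2 then 1 else 0

theorem measurable_choiceReward : Measurable choiceReward :=
  (measurable_from_top : Measurable fun b : Bool => (bif b then 1 else 0 : I)).comp measurable_snd

/-- The environment faced by the machine of arm `x` in MultiSBM. -/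
def duelEnv (ν : Kernel X I) (x : X) : Kernel X I :=
  ((duelKernel ν).map choiceReward).comap (fun y => (x, y)) measurable_prodMk_left

variable (ν : Kernel X I) [IsMarkovKernel ν]

instance duelEnv_isMarkov (x : X) : IsMarkovKernel (duelEnv ν x) := by
  have := Kernel.IsMarkovKernel.map (duelKernel ν) measurable_choiceReward
  unfold duelEnv; infer_instance

theorem integral_duelKernel_utilities {f : I × I → ℝ} (hf : Measurable f) {C : ℝ}
    (hC : ∀ p, |f p| ≤ C) (x y : X) :
    ∫ q, f q.1 ∂duelKernel ν (x, y) = ∫ p, f p ∂(ν x).prod (ν y) := by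
  rw [duelKernel, ProbabilityTheory.integral_compProd]
  · simp only [integral_const, probReal_univ, one_smul, Kernel.parallelComp_apply]
  · exact Integrable.of_bound (hf.comp measurable_fst).aestronglyMeasurable C
      (Filter.Eventually.of_forall fun p => hC _)

theorem abs_coe_le_one (r : I) : |(r : ℝ)| ≤ 1 := by
  rw [abs_of_nonneg r.2.1]; exact r.2.2

theorem integral_left_utility (x y : X) :
    ∫ p : I × I, (p.1 : ℝ) ∂(ν x).prod (ν y) = armMean ν x := by
  simpa [armMean] using integral_fun_fst (μ := ν x) (ν := ν y) (fun r : I => (r : ℝ))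

theorem integral_right_utility (x y : X) :
    ∫ p : I × I, (p.2 : ℝ) ∂(ν x).prod (ν y) = armMean ν y := by
  simpa [armMean] using integral_fun_snd (μ := ν x) (ν := ν y) (fun r : I => (r : ℝ))

theorem integral_choiceKernel (p : I × I) :
    ∫ b, ((bif b then 1 else 0 : I) : ℝ) ∂choiceKernel p = linearLink p := by
  change ∫ b, ((bif b then 1 else 0 : I) : ℝ) ∂bernoulliMeasure true false (linearLink p) = _
  simp [integral_bernoulliMeasure]

theorem armMean_duelEnv (x y : X) :
    armMean (duelEnv ν x) y = (1 + armMean ν y - armMean ν x) / 2 := by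
  have hc := measurable_choiceReward
  have hi1 : Integrable (fun p : I × I => (p.1 : ℝ)) ((ν x).prod (ν y)) :=
    Integrable.of_bound (Measurable.aestronglyMeasurable (by fun_prop)) 1
      (Filter.Eventually.of_forall fun p => abs_coe_le_one _)
  have hi2 : Integrable (fun p : I × I => (p.2 : ℝ)) ((ν x).prod (ν y)) :=
    Integrable.of_bound (Measurable.aestronglyMeasurable (by fun_prop)) 1
      (Filter.Eventually.of_forall fun p => abs_coe_le_one _)
  rw [armMean, duelEnv, Kernel.comap_apply, Kernel.map_apply _ hc,
    integral_map hc.aemeasurable (Measurable.aestronglyMeasurable (by fun_prop)), duelKernel,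
    ProbabilityTheory.integral_compProd]
  · simp only [choiceReward, Kernel.comap_apply, integral_choiceKernel, Kernel.parallelComp_apply,
      linearLink]
    have hi3 : Integrable (fun p : I × I => 1 + (p.2 : ℝ)) ((ν x).prod (ν y)) :=
      (integrable_const _).add hi2
    rw [integral_div, integral_sub hi3 hi1,
      integral_add (integrable_const _) hi2, integral_left_utility, integral_right_utility]
    simp
  · exact Integrable.of_bound (Measurable.aestronglyMeasurable (by fun_prop)) 1
      (Filter.Eventually.of_forall fun p => abs_coe_le_one _)

/-- By linearity of the link, the mean feedback is an increasing affine function of the mean of `y`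
with slope `1/2`, so the order of the arms is kept for every left arm. -/
theorem armGap_duelEnv [Finite X] [Nonempty X] (x y : X) :
    armGap (duelEnv ν x) y = armGap ν y / 2 := by
  obtain ⟨xs, hxs⟩ := exists_eq_ciSup_of_finite (f := armMean ν)
  have h : ⨆ z, armMean (duelEnv ν x) z = armMean (duelEnv ν x) xs := by
    refine le_antisymm (ciSup_le fun z => ?_) (le_ciSup (bddAbove_armMean _) xs)
    rw [armMean_duelEnv, armMean_duelEnv]
    have := le_ciSup (bddAbove_armMean ν) z
    linarith
  rw [armGap, h, armMean_duelEnv, armMean_duelEnv, armGap, ← hxs]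
  ring

end Duel

/-! ### Decoupling the machines inside MultiSBM. -/

section MultiSBM

variable {X : Type u} [Fintype X] [DecidableEq X] [MeasurableSpace X] [DiscreteMeasurableSpace X]
  {M : Type v} [MeasurableSpace M]

instance gameLaw_isProbability {X : Type u} [MeasurableSpace X] {D : Type*} [MeasurableSpace D]
    (A : DuelingAlgorithm X D) (ν : Kernel X I) [IsMarkovKernel ν] (T : ℕ) :
    IsProbabilityMeasure (A.gameLaw ν T) :=
  runLaw_isProbability _ _ _

/-- The state and output of a round of MultiSBM started in state `d`, in which the machine moves
to memory `m` and suggests `y`, and the duel results in `o`. -/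
def multiRound (S : X → SBM X M) (d : (X × X) × (X → M)) (m : M) (y : X) (o : (I × I) × Bool) :
    ((X × X) × (X → M)) × ((X × X) × ((I × I) × Bool)) :=
  (((d.1.2, y), Function.update d.2 d.1.2 ((S d.1.2).feedback (m, choiceReward o))),
    ((d.1.2, y), o))

omit [Fintype X] [DiscreteMeasurableSpace X] in
theorem measurable_multiRound (S : X → SBM X M) (d : (X × X) × (X → M)) :
    Measurable fun p : (M × X) × ((I × I) × Bool) => multiRound S d p.1.1 p.1.2 p.2 := by
  have h1 := (S d.1.2).measurable_feedback
  have h2 := measurable_choiceReward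
  refine Measurable.prodMk (Measurable.prodMk (by fun_prop) ?_) (by fun_prop)
  exact (measurable_update d.2).comp (h1.comp (by fun_prop))

/-- Unfolds the composite kernel once, so that a round reads: advance the machine of the previous
right arm, then duel. -/
theorem lintegral_multiSBM_duelStep (S : X → SBM X M) (y₀ : X) (ν : Kernel X I)
    [IsMarkovKernel ν] (d : (X × X) × (X → M))
    {F : ((X × X) × (X → M)) × ((X × X) × ((I × I) × Bool)) → ENNReal} (hF : Measurable F) :
    ∫⁻ q, F q ∂(multiSBM S y₀).duelStep ν d =
      ∫⁻ a, ∫⁻ o, F (multiRound S d a.1 a.2 o) ∂duelKernel ν (d.1.2, a.2)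
        ∂(S d.1.2).advance (d.2 d.1.2) := by
  have hobs := (multiSBM S y₀).measurable_observe
  have hm : Measurable fun q : (((X × X) × (X → M)) × (X × X)) × ((I × I) × Bool) =>
      ((multiSBM S y₀).observe (q.1.1, q.2.2), (q.1.2, q.2)) :=
    (hobs.comp (by fun_prop)).prodMk (by fun_prop)
  have hc : Measurable fun q : ((X × X) × (X → M)) × (M × X) =>
      (((q.1.1.2, q.2.2), Function.update q.1.2 q.1.1.2 q.2.1), (q.1.1.2, q.2.2)) := by
    refine Measurable.prodMk (Measurable.prodMk (by fun_prop) ?_) (by fun_prop)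
    exact measurable_update_aux (by fun_prop) (by fun_prop) (by fun_prop)
  have hF2 : Measurable fun p : ((X × X) × (X → M)) × (X × X) =>
      ∫⁻ o, F ((multiSBM S y₀).observe (p.1, o.2), (p.2, o)) ∂duelKernel ν p.2 :=
    Measurable.lintegral_kernel_prod_right (κ := (duelKernel ν).comap Prod.snd measurable_snd)
      (f := fun p o => F ((multiSBM S y₀).observe (p.1, o.2), (p.2, o))) (hF.comp hm)
  rw [DuelingAlgorithm.duelStep, Kernel.lintegral_map _ hm _ hF]
  refine (Kernel.lintegral_compProd _ _ _ (hF.comp hm)).trans ?_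
  change ∫⁻ p, ∫⁻ o, F ((multiSBM S y₀).observe (p.1, o.2), (p.2, o)) ∂duelKernel ν p.2
    ∂((Kernel.id ×ₖ multiAdvance S).map fun q : ((X × X) × (X → M)) × (M × X) =>
      (((q.1.1.2, q.2.2), Function.update q.1.2 q.1.1.2 q.2.1), (q.1.1.2, q.2.2))) d = _
  rw [Kernel.lintegral_map _ hc _ hF2]
  refine (Kernel.lintegral_id_prod (hF2.comp hc) _ _).trans ?_
  change ∫⁻ a, _ ∂(S d.1.2).advance (d.2 d.1.2) = _
  simp [multiSBM, multiRound, choiceReward]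

theorem ae_multiSBM_duelStep (S : X → SBM X M) (y₀ : X) (ν : Kernel X I)
    [IsMarkovKernel ν] (d : (X × X) × (X → M))
    {P : ((X × X) × (X → M)) × ((X × X) × ((I × I) × Bool)) → Prop} (hP : MeasurableSet {q | P q})
    (h : ∀ m y o, P (multiRound S d m y o)) : ∀ᵐ q ∂(multiSBM S y₀).duelStep ν d, P q := by
  have h1 := lintegral_multiSBM_duelStep S y₀ ν d
    ((measurable_const : Measurable fun _ => (1 : ENNReal)).indicator hP.compl)
  rw [lintegral_indicator_const hP.compl, one_mul] at h1
  refine h1.trans ?_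
  simp [h]

theorem multiSBM_duelStep (S : X → SBM X M) (y₀ : X) (ν : Kernel X I) [IsMarkovKernel ν]
    (d : (X × X) × (X → M)) :
    (multiSBM S y₀).duelStep ν d = ((S d.1.2).advance (d.2 d.1.2) ⊗ₘ
      (duelKernel ν).comap (fun a : M × X => (d.1.2, a.2)) (by fun_prop)).map
        fun p => multiRound S d p.1.1 p.1.2 p.2 := by
  refine Measure.ext_of_lintegral _ fun F hF => ?_
  rw [lintegral_multiSBM_duelStep S y₀ ν d hF, lintegral_map hF (measurable_multiRound S d)]
  exact (Measure.lintegral_compProd (κ := (duelKernel ν).comap (fun a : M × X => (d.1.2, a.2))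
    (by fun_prop)) (hF.comp (measurable_multiRound S d))).symm

/-- The records of MultiSBM in which the left arm is `x`. -/
def leftArm (x : X) : Set ((X × X) × ((I × I) × Bool)) := {o | o.1.1 = x}

omit [Fintype X] [DecidableEq X] in
theorem measurableSet_leftArm (x : X) : MeasurableSet (leftArm x) :=
  measurableSet_arm_eq (f := fun o : (X × X) × ((I × I) × Bool) => o.1.1) (by fun_prop) x

/-- The number of times that the right arm is `y` in the first `B` rounds with left arm `x`. -/
def rightCount (x y : X) (B : ℕ) {T : ℕ} (h : Fin T → (X × X) × ((I × I) × Bool)) : ℝ :=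
  cappedSum (leftArm x) (fun o => if o.1.2 = y then 1 else 0) B T h

omit [Fintype X] in
theorem measurable_rightCount (x y : X) (B T : ℕ) :
    Measurable fun h : Fin T → (X × X) × ((I × I) × Bool) => rightCount x y B h :=
  measurable_cappedSum (measurableSet_leftArm x) (measurable_indicator_arm (by fun_prop) y) B T

/-- The machine of arm `x` in MultiSBM behaves as in the bandit game against `duelEnv ν x`. -/
theorem gameLaw_rightCount_le (S : X → SBM X M) (y₀ : X) (ν : Kernel X I) [IsMarkovKernel ν]
    (x y : X) (B T : ℕ) (s : ℝ) :
    ((multiSBM S y₀).gameLaw ν T).real {p | s < rightCount x y B p.2} ≤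
      ((S x).mabLaw (duelEnv ν x) B).real {p | s < (playCount y p.2 : ℝ)} := by
  set W := tailValue (S x) (duelEnv ν x) y s with hW
  have hWm := measurable_tailValue (S x) (duelEnv ν x) y s
  have hF : ∀ n, Measurable fun p : ((X × X) × (X → M)) × (Fin n → (X × X) × ((I × I) × Bool)) =>
      W (B - visits (leftArm x) p.2) (p.1.2 x, rightCount x y B p.2) := by
    intro n
    have h1 : Measurable fun q : ℕ × (M × ℝ) => W q.1 q.2 :=
      measurable_from_prod_countable_right fun j => hWm j
    refine h1.comp (Measurable.prodMk ?_ (Measurable.prodMk (by fun_prop) ?_))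
    · exact (measurable_from_top : Measurable fun k : ℕ => B - k).comp
        ((measurable_visits (measurableSet_leftArm x) n).comp measurable_snd)
    · exact (measurable_rightCount x y B n).comp measurable_snd
  -- The potential is the value of `S x` with its remaining call budget. A call to `S x` within the
  -- budget is exactly one bandit step in `duelEnv ν x`.
  have hstep : ∀ n < T, ∀ d (h : Fin n → (X × X) × ((I × I) × Bool)),
      ∫⁻ q, W (B - visits (leftArm x)
          (Fin.snoc h q.2 : Fin (n + 1) → (X × X) × ((I × I) × Bool)))
        (q.1.2 x, rightCount x y B
          (Fin.snoc h q.2 : Fin (n + 1) → (X × X) × ((I × I) × Bool)))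
        ∂(multiSBM S y₀).duelStep ν d ≤
      W (B - visits (leftArm x) h) (d.2 x, rightCount x y B h) := by
    intro n _ d h
    refine (lintegral_multiSBM_duelStep S y₀ ν d ((hF (n + 1)).comp ((measurable_snoc_aux n).comp
      (measurable_prodMk_left (x := (d, h)))))).trans_le ?_
    simp only [Function.comp_apply]
    simp only [rightCount, cappedSum_snoc, visits_snoc, multiRound, leftArm, Set.mem_ofPred_eq]
    by_cases hd : d.1.2 = x
    · subst hd
      by_cases hv : visits {o : (X × X) × ((I × I) × Bool) | o.1.1 = d.1.2} h < B
      · simp only [if_true, hv, and_self, Function.update_self]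
        rw [show B - visits {o : (X × X) × ((I × I) × Bool) | o.1.1 = d.1.2} h =
          B - (visits {o : (X × X) × ((I × I) × Bool) | o.1.1 = d.1.2} h + 1) + 1 by omega]
        conv_rhs => rw [hW, tailValue, ← hW]
        rw [lintegral_mabStep]
        · refine lintegral_mono fun a => ?_
          have h1 : Measurable fun r : I => W
            (B - (visits {o : (X × X) × ((I × I) × Bool) | o.1.1 = d.1.2} h + 1))
            ((S d.1.2).feedback (a.1, r),
              cappedSum {o : (X × X) × ((I × I) × Bool) | o.1.1 = d.1.2}
                (fun o => if o.1.2 = y then 1 else 0) B n h + if a.2 = y then 1 else 0) :=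
            (hWm _).comp ((((S d.1.2).measurable_feedback).comp (by fun_prop)).prodMk
              measurable_const)
          simp only
          rw [duelEnv, Kernel.comap_apply, Kernel.lintegral_map _ measurable_choiceReward _ h1]
        · exact (hWm _).comp (Measurable.prodMk (by fun_prop)
            (measurable_const.add (measurable_indicator_arm (by fun_prop) y)))
      -- With the budget exhausted the count is frozen, and `W 0` ignores the memory.
      · simp only [hv, and_false, if_false, add_zero, if_true]
        rw [Nat.sub_eq_zero_of_le (by omega), Nat.sub_eq_zero_of_le (by omega)]
        refine (lintegral_mono (g := fun _ => W 0 (d.2 d.1.2, rightCount d.1.2 y B h)) fun a =>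
          (lintegral_mono (g := fun _ => W 0 (d.2 d.1.2, rightCount d.1.2 y B h))
            fun o => le_rfl).trans ?_).trans ?_
        · simp
        · simp only [lintegral_const, measure_univ, mul_one, rightCount, leftArm, le_refl]
    -- When another machine is called, neither the memory of `S x` nor its count changes.
    · simp [hd, Ne.symm hd]
  have hle := lintegral_runLaw_le ((multiSBM S y₀).duelStep ν) (multiSBM S y₀).start hF T hstep
  refine ENNReal.toReal_mono (measure_ne_top _ _) ?_
  have hs : MeasurableSet {p : ((X × X) × (X → M)) × (Fin T → (X × X) × ((I × I) × Bool)) |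
      s < rightCount x y B p.2} :=
    measurableSet_lt measurable_const ((measurable_rightCount x y B T).comp measurable_snd)
  refine le_trans ?_ (hle.trans ?_)
  · rw [DuelingAlgorithm.gameLaw, ← lintegral_indicator_one hs]
    refine lintegral_mono fun p => ?_
    by_cases hp : s < rightCount x y B p.2
    · simp only [Set.indicator, Set.mem_ofPred_eq, hp, if_true, Pi.one_apply]
      exact one_le_tailValue _ _ _ _ hp
    · simp [hp]
  · exact tailValue_le (S x) (duelEnv ν x) y s B

end MultiSBM

/-! ### From polynomial tails to expectations. -/

section Tails

theorem sum_inv_sq_le {s : ℝ} (hs : 1 < s) (T : ℕ) :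
    ∑ j ∈ Finset.range T, 1 / (s + j) ^ 2 ≤ 1 / (s - 1) := by
  suffices h : ∑ j ∈ Finset.range T, 1 / (s + j) ^ 2 ≤ 1 / (s - 1) - 1 / (s - 1 + T) by
    have h1 : 0 ≤ 1 / (s - 1 + T) := by
      have : (0 : ℝ) ≤ T := by positivity
      exact one_div_nonneg.2 (by linarith)
    linarith
  induction T with
  | zero => simp
  | succ T ih =>
    rw [Finset.sum_range_succ]
    have hT : (0 : ℝ) ≤ T := by positivity
    have h1 : 0 < s - 1 + T := by linarith
    have h2 : 0 < s + T := by linarith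
    have h3 : 1 / (s + T) ^ 2 ≤ 1 / (s - 1 + T) - 1 / (s - 1 + (T + 1)) := by
      rw [show s - 1 + ((T : ℝ) + 1) = s + T by ring, div_sub_div _ _ h1.ne' h2.ne',
        div_le_div_iff₀ (by positivity) (by positivity)]
      nlinarith
    push_cast
    linarith

/-- Since `s / 2 ≥ 1`, the exponent can be weakened to `2`, which gives a summable bound uniform in
`α`. -/
theorem rpow_neg_le_inv_sq {α s : ℝ} (hα : 3 ≤ α) (hs : 2 ≤ s) :
    2 / α * (s / 2) ^ (-α) ≤ 8 / 3 * (1 / s ^ 2) := by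
  have h1 : (s / 2) ^ (-α) ≤ (s / 2) ^ (-2 : ℝ) :=
    Real.rpow_le_rpow_of_exponent_le (by linarith) (by linarith)
  have h2 : (s / 2) ^ (-2 : ℝ) = 4 * (1 / s ^ 2) := by
    rw [Real.rpow_neg (by linarith), Real.rpow_two, div_pow, inv_div]
    ring
  have h3 : 2 / α ≤ 2 / 3 := by gcongr
  calc _ ≤ 2 / 3 * (4 * (1 / s ^ 2)) := by
        rw [← h2]; exact mul_le_mul h3 h1 (by positivity) (by norm_num)
    _ = _ := by ring

variable {Ω : Type*} [MeasurableSpace Ω] {P : Measure Ω} [IsProbabilityMeasure P]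

/-- A polynomial tail beyond `s₀` contributes at most `1` to the expectation. -/
theorem integral_excess_le {N : Ω → ℝ} (hN : Measurable N) {T : ℕ} (hT : ∀ ω, N ω ≤ T)
    {α s₀ : ℝ} (hα : 3 ≤ α) (hs₀ : 4 ≤ s₀)
    (h : ∀ s, s₀ ≤ s → P.real {ω | s < N ω} ≤ 2 / α * (s / 2) ^ (-α)) :
    ∫ ω, max (N ω - s₀) 0 ∂P ≤ 1 := by
  have hset : ∀ s, MeasurableSet {ω | s < N ω} := fun s => measurableSet_lt measurable_const hN
  -- Discrete layer cake: the excess is at most the number of integers `j` with `s₀ + j < N`, and `N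
  -- ≤ T` limits these to `j < T`.
  have hpt : ∀ ω, max (N ω - s₀) 0 ≤
      ∑ j ∈ Finset.range T, {ω | s₀ + j < N ω}.indicator (fun _ => (1 : ℝ)) ω := by
    intro ω
    have hsum0 : 0 ≤ ∑ j ∈ Finset.range T, {ω | s₀ + j < N ω}.indicator (fun _ => (1 : ℝ)) ω :=
      Finset.sum_nonneg fun j _ => Set.indicator_nonneg (fun _ _ => zero_le_one) _
    refine max_le ?_ hsum0
    rcases le_or_gt (N ω) s₀ with hle | hlt
    · linarith
    set m := ⌈N ω - s₀⌉₊ with hm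
    have hmT : m ≤ T := Nat.ceil_le.2 (by linarith [hT ω])
    calc N ω - s₀ ≤ m := Nat.le_ceil _
      _ = ∑ j ∈ Finset.range m, {ω | s₀ + j < N ω}.indicator (fun _ => (1 : ℝ)) ω := by
          have hone : ∀ j ∈ Finset.range m,
              {ω | s₀ + (j : ℝ) < N ω}.indicator (fun _ => (1 : ℝ)) ω = 1 := by
            intro j hj
            have := Nat.lt_ceil.1 (Finset.mem_range.1 hj)
            exact Set.indicator_of_mem (s := {ω | s₀ + (j : ℝ) < N ω})
              (show s₀ + (j : ℝ) < N ω by linarith) _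
          rw [Finset.sum_congr rfl hone]
          simp
      _ ≤ _ := Finset.sum_le_sum_of_subset_of_nonneg (Finset.range_subset_range.2 hmT)
          fun j _ _ => Set.indicator_nonneg (fun _ _ => zero_le_one) _
  have hint : ∀ j : ℕ, Integrable ({ω | s₀ + (j : ℝ) < N ω}.indicator fun _ => (1 : ℝ)) P :=
    fun j => (integrable_const 1).indicator (hset _)
  calc ∫ ω, max (N ω - s₀) 0 ∂P
      ≤ ∫ ω, ∑ j ∈ Finset.range T, {ω | s₀ + j < N ω}.indicator (fun _ => (1 : ℝ)) ω ∂P :=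
        integral_mono_of_nonneg (Filter.Eventually.of_forall fun ω => le_max_right _ _)
          (integrable_finsetSum _ fun j _ => hint j) (Filter.Eventually.of_forall hpt)
    _ = ∑ j ∈ Finset.range T, P.real {ω | s₀ + j < N ω} := by
        rw [integral_finsetSum _ fun j _ => hint j]
        refine Finset.sum_congr rfl fun j _ => ?_
        rw [integral_indicator_const _ (hset _)]
        simp
    _ ≤ ∑ j ∈ Finset.range T, 8 / 3 * (1 / (s₀ + j) ^ 2) := by
        refine Finset.sum_le_sum fun j _ => ?_
        have hj : (0 : ℝ) ≤ j := by positivity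
        exact (h _ (by linarith)).trans (rpow_neg_le_inv_sq hα (by linarith))
    _ ≤ 8 / 3 * (1 / (s₀ - 1)) := by
        rw [← Finset.mul_sum]
        exact mul_le_mul_of_nonneg_left (sum_inv_sq_le (by linarith) T) (by norm_num)
    _ ≤ 8 / 3 * (1 / 3) := by gcongr; linarith
    _ ≤ 1 := by norm_num

theorem integral_le_of_excess {N : Ω → ℝ} (hN : Measurable N) {T : ℝ} (h0 : ∀ ω, 0 ≤ N ω)
    (hT : ∀ ω, N ω ≤ T) {s₀ : ℝ} (hs₀ : 0 ≤ s₀) (h : ∫ ω, max (N ω - s₀) 0 ∂P ≤ 1) :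
    ∫ ω, N ω ∂P ≤ s₀ + 1 := by
  have hi : Integrable (fun ω => max (N ω - s₀) 0) P := by
    refine Integrable.of_bound (Measurable.aestronglyMeasurable (by fun_prop)) T
      (Filter.Eventually.of_forall fun ω => ?_)
    have h1 := h0 ω
    have h2 := hT ω
    rw [Real.norm_eq_abs, abs_of_nonneg (le_max_right _ _)]
    exact max_le (by linarith) (by linarith)
  calc ∫ ω, N ω ∂P ≤ ∫ ω, (s₀ + max (N ω - s₀) 0) ∂P :=
        integral_mono_of_nonneg (Filter.Eventually.of_forall h0) ((integrable_const _).add hi)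
          (Filter.Eventually.of_forall fun ω => by
            change N ω ≤ s₀ + max (N ω - s₀) 0
            linarith [le_max_left (N ω - s₀) 0])
    _ = s₀ + ∫ ω, max (N ω - s₀) 0 ∂P := by
        rw [integral_add (integrable_const _) hi]; simp
    _ ≤ _ := by linarith

end Tails

/-! ### The regret of MultiSBM in terms of right arm counts. -/

section MultiSBM

variable {X : Type u} [Fintype X] [DecidableEq X] [MeasurableSpace X] [DiscreteMeasurableSpace X]
  {M : Type v} [MeasurableSpace M]

theorem cappedSum_nonneg {O : Type*} (A : Set O) {w : O → ℝ} (hw : ∀ o, 0 ≤ w o) (k n : ℕ)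
    (h : Fin n → O) : 0 ≤ cappedSum A w k n h := by
  classical
  refine snoc_induction (P := fun n h => 0 ≤ cappedSum A w k n h) (by simp) ?_ n h
  intro n h o ih
  rw [cappedSum_snoc]
  split_ifs
  · linarith [hw o]
  · linarith

theorem cappedSum_le {O : Type*} (A : Set O) {w : O → ℝ} (hw : ∀ o, w o ≤ 1) (k n : ℕ)
    (h : Fin n → O) : cappedSum A w k n h ≤ n := by
  classical
  refine snoc_induction (P := fun n h => cappedSum A w k n h ≤ n) (by simp) ?_ n h
  intro n h o ih
  rw [cappedSum_snoc]
  push_cast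
  split_ifs
  · linarith [hw o]
  · linarith

omit [Fintype X] [MeasurableSpace X] [DiscreteMeasurableSpace X] in
theorem rightCount_nonneg (x y : X) (B : ℕ) {T : ℕ}
    (h : Fin T → (X × X) × ((I × I) × Bool)) : 0 ≤ rightCount x y B h :=
  cappedSum_nonneg _ (fun o => by split_ifs <;> simp) _ _ _

omit [Fintype X] [MeasurableSpace X] [DiscreteMeasurableSpace X] in
theorem rightCount_le (x y : X) (B : ℕ) {T : ℕ}
    (h : Fin T → (X × X) × ((I × I) × Bool)) : rightCount x y B h ≤ T :=
  cappedSum_le _ (fun o => by split_ifs <;> simp) _ _ _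

omit [Fintype X] [MeasurableSpace X] [DiscreteMeasurableSpace X] in
theorem rightCount_eq_sum (x y : X) {B : ℕ} {T : ℕ} (h : Fin T → (X × X) × ((I × I) × Bool))
    (hB : visits (leftArm x) h ≤ B) :
    rightCount x y B h = ∑ t, if (h t).1.1 = x then (if (h t).1.2 = y then 1 else 0) else 0 := by
  rw [rightCount, cappedSum_eq_sum _ _ _ _ hB]
  refine Finset.sum_congr rfl fun t _ => ?_
  by_cases ht : (h t).1.1 = x <;> simp [ht, leftArm]

omit [MeasurableSpace X] [DiscreteMeasurableSpace X] in
theorem sum_right_eq (φ : X → ℝ) {T : ℕ} (h : Fin T → (X × X) × ((I × I) × Bool)) :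
    ∑ t, φ (h t).1.2 = ∑ y, φ y * ∑ x, rightCount x y T h := by
  simp only [rightCount_eq_sum _ _ h (visits_le _ _), Finset.mul_sum]
  have : ∀ y, ∑ x, ∑ t, φ y * (if (h t).1.1 = x then (if (h t).1.2 = y then 1 else 0) else 0) =
      ∑ t, if (h t).1.2 = y then φ y else 0 := by
    intro y
    rw [Finset.sum_comm]
    refine Finset.sum_congr rfl fun t _ => ?_
    simp [mul_ite]
  rw [Finset.sum_congr rfl fun y _ => this y, Finset.sum_comm]
  simp

omit [Fintype X] [DecidableEq X] in
theorem measurable_arm_sum (φ : X → ℝ) {E : Type*} [MeasurableSpace E] {T : ℕ}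
    {f : Fin T → E → X} (hf : ∀ t, Measurable (f t)) : Measurable fun e => ∑ t, φ (f t e) :=
  Finset.measurable_sum _ fun t _ => (Measurable.of_discrete : Measurable φ).comp (hf t)

/-- The left arms are the right arms of the previous round. -/
theorem ae_left_right (S : X → SBM X M) (y₀ : X) (ν : Kernel X I) [IsMarkovKernel ν] (T : ℕ)
    (φ : X → ℝ) : ∀ᵐ p ∂(multiSBM S y₀).gameLaw ν T,
      ∑ t, φ (p.2 t).1.1 + φ p.1.1.2 = φ y₀ + ∑ t, φ (p.2 t).1.2 := by
  have hP : ∀ n, MeasurableSet {p : ((X × X) × (X → M)) × (Fin n → (X × X) × ((I × I) × Bool)) |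
      ∑ t, φ (p.2 t).1.1 + φ p.1.1.2 = φ y₀ + ∑ t, φ (p.2 t).1.2} := by
    intro n
    have hφ : Measurable φ := Measurable.of_discrete
    refine measurableSet_eq_fun ?_ ?_
    · exact (measurable_arm_sum φ fun t => by fun_prop).add (hφ.comp (by fun_prop))
    · exact measurable_const.add (measurable_arm_sum φ fun t => by fun_prop)
  refine ae_runLaw _ _ hP ?_ ?_ T
  · simp [multiSBM]
  · intro n d h hh
    refine ae_multiSBM_duelStep S y₀ ν d ?_ fun m y o => ?_
    · exact ((measurable_snoc_aux n).comp (measurable_prodMk_left (x := (d, h)))) (hP (n + 1))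
    · simp only [Fin.sum_univ_castSucc, Fin.snoc_castSucc, Fin.snoc_last, multiRound]
      simp only at hh
      linarith

/-- Every call to the machine of `x` except possibly the first follows a suggestion of `x` by some
machine; the `1` covers the initial arm. -/
theorem ae_visits_leftArm_le (S : X → SBM X M) (y₀ : X) (ν : Kernel X I) [IsMarkovKernel ν]
    (T : ℕ) (x : X) : ∀ᵐ p ∂(multiSBM S y₀).gameLaw ν T,
      (visits (leftArm x) p.2 : ℝ) ≤ 1 + ∑ z, rightCount z x T p.2 := by
  filter_upwards [ae_left_right S y₀ ν T fun z => if z = x then 1 else 0] with p hp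
  rw [sum_right_eq (fun z => if z = x then 1 else 0)] at hp
  have h1 : (visits (leftArm x) p.2 : ℝ) = ∑ t, if (p.2 t).1.1 = x then (1 : ℝ) else 0 := by
    rw [visits]
    push_cast
    refine Finset.sum_congr rfl fun t _ => ?_
    by_cases ht : (p.2 t).1.1 = x <;> simp [ht, leftArm]
  rw [h1]
  simp only [ite_mul, one_mul, zero_mul, Finset.sum_ite_eq', Finset.mem_univ, if_true] at hp
  have h2 : (0 : ℝ) ≤ if p.1.1.2 = x then 1 else 0 := by split_ifs <;> simp
  have h3 : (if y₀ = x then 1 else 0 : ℝ) ≤ 1 := by split_ifs <;> simp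
  linarith

theorem integral_multiSBM_duelStep_eq_zero (S : X → SBM X M) (y₀ : X) (ν : Kernel X I)
    [IsMarkovKernel ν] (d : (X × X) × (X → M)) :
    ∫ q, ((armMean ν q.2.1.1 - q.2.2.1.1) + (armMean ν q.2.1.2 - q.2.2.1.2)) / 2
      ∂(multiSBM S y₀).duelStep ν d = 0 := by
  have hmean : Measurable (armMean ν) := Measurable.of_discrete
  have hb2 : ∀ x, |armMean ν x| ≤ 1 := fun x => by
    rw [abs_of_nonneg (armMean_nonneg ν x)]; exact armMean_le_one ν x
  have hm := measurable_multiRound S d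
  have hg : Measurable fun q : ((X × X) × (X → M)) × ((X × X) × ((I × I) × Bool)) =>
      ((armMean ν q.2.1.1 - q.2.2.1.1) + (armMean ν q.2.1.2 - q.2.2.1.2)) / 2 := by fun_prop
  have hbound : ∀ (a b c e : ℝ), |a| ≤ 1 → |b| ≤ 1 → |c| ≤ 1 → |e| ≤ 1 →
      |((a - b) + (c - e)) / 2| ≤ 2 := by
    intro a b c e ha hb hc he
    rw [abs_le] at *
    constructor <;> linarith
  rw [multiSBM_duelStep, integral_map hm.aemeasurable hg.aestronglyMeasurable,
    Measure.integral_compProd]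
  · refine integral_eq_zero_of_ae (Filter.Eventually.of_forall fun a => ?_)
    simp only [multiRound, Kernel.comap_apply, Pi.zero_apply]
    have hi1 : Integrable (fun p : I × I => (p.1 : ℝ)) ((ν d.1.2).prod (ν a.2)) :=
      Integrable.of_bound (Measurable.aestronglyMeasurable (by fun_prop)) 1
        (Filter.Eventually.of_forall fun p => abs_coe_le_one _)
    have hi2 : Integrable (fun p : I × I => (p.2 : ℝ)) ((ν d.1.2).prod (ν a.2)) :=
      Integrable.of_bound (Measurable.aestronglyMeasurable (by fun_prop)) 1
        (Filter.Eventually.of_forall fun p => abs_coe_le_one _)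
    have hk := integral_duelKernel_utilities ν
      (f := fun p => ((armMean ν d.1.2 - p.1) + (armMean ν a.2 - p.2)) / 2) (by fun_prop)
      (C := 2) (fun p => hbound _ _ _ _ (hb2 _) (abs_coe_le_one _) (hb2 _) (abs_coe_le_one _))
      d.1.2 a.2
    have hi3 : Integrable (fun p : I × I => armMean ν d.1.2 - (p.1 : ℝ))
      ((ν d.1.2).prod (ν a.2)) := (integrable_const _).sub hi1
    have hi4 : Integrable (fun p : I × I => armMean ν a.2 - (p.2 : ℝ))
      ((ν d.1.2).prod (ν a.2)) := (integrable_const _).sub hi2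
    rw [hk, integral_div, integral_add hi3 hi4, integral_sub (integrable_const _) hi1,
      integral_sub (integrable_const _) hi2, integral_left_utility, integral_right_utility]
    simp
  · refine Integrable.of_bound (hg.comp hm).aestronglyMeasurable 2
      (Filter.Eventually.of_forall fun p => ?_)
    exact hbound _ _ _ _ (hb2 _) (abs_coe_le_one _) (hb2 _) (abs_coe_le_one _)

/-- The expected regret of MultiSBM is controlled by the expected right arm counts. -/
theorem expectedRegret_le (S : X → SBM X M) (y₀ : X) (ν : Kernel X I) [IsMarkovKernel ν]
    (T : ℕ) :
    (multiSBM S y₀).expectedRegret ν T ≤ armGap ν y₀ +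
      ∑ y, armGap ν y * ∑ x, ∫ p, rightCount x y T p.2 ∂(multiSBM S y₀).gameLaw ν T := by
  have hmean : Measurable (armMean ν) := Measurable.of_discrete
  have hb2 : ∀ x, |armMean ν x| ≤ 1 := fun x => by
    rw [abs_of_nonneg (armMean_nonneg ν x)]; exact armMean_le_one ν x
  have h0 := integral_sum_runLaw_eq_zero ((multiSBM S y₀).duelStep ν) (multiSBM S y₀).start
    (g := fun o : (X × X) × ((I × I) × Bool) =>
      ((armMean ν o.1.1 - o.2.1.1) + (armMean ν o.1.2 - o.2.1.2)) / 2) (by fun_prop) (C := 2)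
    (fun o => by
      have h1 := hb2 o.1.1
      have h2 := hb2 o.1.2
      have h3 := abs_coe_le_one o.2.1.1
      have h4 := abs_coe_le_one o.2.1.2
      rw [abs_le] at *
      constructor <;> linarith)
    (integral_multiSBM_duelStep_eq_zero S y₀ ν) T
  change ∫ p, _ ∂(multiSBM S y₀).gameLaw ν T = 0 at h0
  have hirc : ∀ x y, Integrable (fun p => rightCount x y T p.2) ((multiSBM S y₀).gameLaw ν T) :=
    fun x y => Integrable.of_bound
      ((measurable_rightCount x y T T).comp measurable_snd).aestronglyMeasurable T
      (Filter.Eventually.of_forall fun p => by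
        rw [Real.norm_eq_abs, abs_of_nonneg (rightCount_nonneg x y T p.2)]
        exact rightCount_le x y T p.2)
  have hig : Integrable (fun p => ∑ t, (((armMean ν (p.2 t).1.1 - (p.2 t).2.1.1) +
      (armMean ν (p.2 t).1.2 - (p.2 t).2.1.2)) / 2)) ((multiSBM S y₀).gameLaw ν T) := by
    refine Integrable.of_bound (Measurable.aestronglyMeasurable (by fun_prop)) (∑ _t : Fin T, 2)
      (Filter.Eventually.of_forall fun p => ?_)
    refine (Finset.abs_sum_le_sum_abs _ _).trans (Finset.sum_le_sum fun t _ => ?_)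
    have h1 := hb2 (p.2 t).1.1
    have h2 := hb2 (p.2 t).1.2
    have h3 := abs_coe_le_one (p.2 t).2.1.1
    have h4 := abs_coe_le_one (p.2 t).2.1.2
    rw [abs_le] at *
    constructor <;> linarith
  have hi2 : Integrable (fun p => ∑ y, armGap ν y * ∑ x, rightCount x y T p.2)
      ((multiSBM S y₀).gameLaw ν T) :=
    integrable_finsetSum _ fun y _ => (integrable_finsetSum _ fun x _ => hirc x y).const_mul _
  have hle : (multiSBM S y₀).expectedRegret ν T ≤
      ∫ p, ((armGap ν y₀ + ∑ y, armGap ν y * ∑ x, rightCount x y T p.2) +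
        ∑ t, (((armMean ν (p.2 t).1.1 - (p.2 t).2.1.1) +
          (armMean ν (p.2 t).1.2 - (p.2 t).2.1.2)) / 2)) ∂(multiSBM S y₀).gameLaw ν T := by
    refine integral_mono_ae ?_ (((integrable_const _).add hi2).add hig) ?_
    · refine Integrable.of_bound (Measurable.aestronglyMeasurable (by fun_prop))
        (∑ _t : Fin T, 2) (Filter.Eventually.of_forall fun p => ?_)
      refine (Finset.abs_sum_le_sum_abs _ _).trans (Finset.sum_le_sum fun t _ => ?_)
      have h0 : |⨆ z, armMean ν z| ≤ 1 := by
        rw [abs_of_nonneg (Real.iSup_nonneg (armMean_nonneg ν))]; exact iSup_armMean_le_one ν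
      have h3 := abs_coe_le_one (p.2 t).2.1.1
      have h4 := abs_coe_le_one (p.2 t).2.1.2
      rw [abs_le] at *
      constructor <;> linarith
    -- The left gaps sum to the right gaps plus that of `y₀` minus the last one, so half of each sum
    -- is at most the right sum plus the gap of `y₀`.
    · filter_upwards [ae_left_right S y₀ ν T (armGap ν)] with p hp
      rw [← sum_right_eq]
      have h1 : ∑ t, ((⨆ z, armMean ν z) - (((p.2 t).2.1.1 : ℝ) + ((p.2 t).2.1.2 : ℝ)) / 2) =
          (∑ t, armGap ν (p.2 t).1.1) / 2 + (∑ t, armGap ν (p.2 t).1.2) / 2 +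
          ∑ t, (((armMean ν (p.2 t).1.1 - (p.2 t).2.1.1) +
          (armMean ν (p.2 t).1.2 - (p.2 t).2.1.2)) / 2) := by
        rw [Finset.sum_div, Finset.sum_div, ← Finset.sum_add_distrib, ← Finset.sum_add_distrib]
        refine Finset.sum_congr rfl fun t _ => ?_
        unfold armGap; ring
      rw [h1]
      have h2 := armGap_nonneg ν p.1.1.2
      have h3 := armGap_nonneg ν y₀
      linarith
  refine hle.trans (le_of_eq ?_)
  have hi3 : Integrable (fun p => armGap ν y₀ + ∑ y, armGap ν y * ∑ x, rightCount x y T p.2)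
      ((multiSBM S y₀).gameLaw ν T) := (integrable_const _).add hi2
  rw [integral_add hi3 hig, h0, integral_add (integrable_const _) hi2,
    integral_finsetSum _ fun y _ => (integrable_finsetSum _ fun x _ => hirc x y).const_mul _]
  simp only [integral_const, probReal_univ, one_smul, add_zero, integral_const_mul]
  congr 1
  refine Finset.sum_congr rfl fun y _ => ?_
  rw [integral_finsetSum _ fun x _ => hirc x y]

end MultiSBM

/-! ### Expected counts for the machine of the best arm and for those of suboptimal arms. -/

section Counts

variable {X : Type u} [Fintype X] [DecidableEq X] [Nonempty X] [MeasurableSpace X]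
  [DiscreteMeasurableSpace X] {M : Type v} [MeasurableSpace M]

/-- Robustness transported into the game. The halved gap turns the factor `4α` into `16α`, and the
logarithm involves the call budget `B` rather than `T`. -/
theorem gameLaw_tail {S : X → SBM X M} {α : ℝ} (hS : ∀ x, (S x).IsRobust α) (y₀ : X)
    (ν : Kernel X I) [IsMarkovKernel ν] (x : X) {y : X} (hy : 0 < armGap ν y) (B T : ℕ) {s : ℝ}
    (hs : 0 < s) (hsB : 16 * α / armGap ν y ^ 2 * Real.log B ≤ s) :
    ((multiSBM S y₀).gameLaw ν T).real {p | s < rightCount x y B p.2} ≤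
      2 / α * (s / 2) ^ (-α) := by
  refine (gameLaw_rightCount_le S y₀ ν x y B T s).trans
    (hS x (duelEnv ν x) B y ?_ s hs ?_).le
  · rw [armGap_duelEnv]; positivity
  · rw [armGap_duelEnv]
    refine le_of_eq_of_le ?_ hsB
    field_simp
    ring

theorem one_le_log_of_three_le {B : ℕ} (hB : 3 ≤ B) : 1.09 ≤ Real.log B := by
  have h1 : Real.log 3 ≤ Real.log B :=
    Real.log_le_log (by norm_num) (by exact_mod_cast hB)
  have h2 : 1 - (3 / Real.exp 1)⁻¹ ≤ Real.log (3 / Real.exp 1) :=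
    Real.one_sub_inv_le_log_of_pos (by positivity)
  rw [Real.log_div (by norm_num) (Real.exp_pos 1).ne', Real.log_exp, inv_div] at h2
  have := Real.exp_one_lt_d9
  linarith

theorem integral_rightCount_excess_le {S : X → SBM X M} {α : ℝ} (hα : 3 ≤ α)
    (hS : ∀ x, (S x).IsRobust α) (y₀ : X) (ν : Kernel X I) [IsMarkovKernel ν] (x : X) {y : X}
    (hy : 0 < armGap ν y) {B : ℕ} (hB : 3 ≤ B) (T : ℕ) :
    ∫ p, max (rightCount x y B p.2 - 16 * α / armGap ν y ^ 2 * Real.log B) 0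
      ∂(multiSBM S y₀).gameLaw ν T ≤ 1 := by
  have hlog := one_le_log_of_three_le hB
  have hg : armGap ν y ^ 2 ≤ 1 := pow_le_one₀ hy.le (armGap_le_one ν y)
  have h1 : 16 * α ≤ 16 * α / armGap ν y ^ 2 := by
    rw [le_div_iff₀ (by positivity)]; nlinarith
  have h4 : 4 ≤ 16 * α / armGap ν y ^ 2 * Real.log B := by nlinarith
  refine integral_excess_le ((measurable_rightCount x y B T).comp measurable_snd)
    (fun p => rightCount_le x y B p.2) hα h4 fun s hs => ?_
  exact gameLaw_tail hS y₀ ν x hy B T (by linarith) hs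

theorem integral_rightCount_le {S : X → SBM X M} {α : ℝ} (hα : 3 ≤ α)
    (hS : ∀ x, (S x).IsRobust α) (y₀ : X) (ν : Kernel X I) [IsMarkovKernel ν] (x : X) {y : X}
    (hy : 0 < armGap ν y) {B : ℕ} (hB : 3 ≤ B) (T : ℕ) :
    ∫ p, rightCount x y B p.2 ∂(multiSBM S y₀).gameLaw ν T ≤
      16 * α / armGap ν y ^ 2 * Real.log B + 1 := by
  have hlog := one_le_log_of_three_le hB
  exact integral_le_of_excess ((measurable_rightCount x y B T).comp measurable_snd)
    (fun p => rightCount_nonneg x y B p.2) (fun p => rightCount_le x y B p.2) (by positivity)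
    (integral_rightCount_excess_le hα hS y₀ ν x hy hB T)

/-- A suboptimal arm is rarely the left arm. -/
theorem visits_leftArm_tail {S : X → SBM X M} {α : ℝ} (hα : 3 ≤ α)
    (hS : ∀ x, (S x).IsRobust α) (y₀ : X) (ν : Kernel X I) [IsMarkovKernel ν] {x : X}
    (hx : 0 < armGap ν x) {T : ℕ} (hT : 3 ≤ T)
    (hK : (Fintype.card X : ℝ) ≤ Real.log T ^ α) {B : ℕ}
    (hB : 1 + Fintype.card X * (16 * α / armGap ν x ^ 2 * Real.log T ^ 2) ≤ B) :
    ((multiSBM S y₀).gameLaw ν T).real {p | B < visits (leftArm x) p.2} ≤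
      2 / (α * Real.log T) := by
  have hL := one_le_log_of_three_le hT
  set L := Real.log T
  set P := (multiSBM S y₀).gameLaw ν T
  -- Robustness only requires one factor `L`. The second makes `(s / 2)^α ≥ L^α · L^α ≥ K · L`,
  -- which pays for the union over the `K` machines and leaves a factor `1 / L`.
  set s := 16 * α / armGap ν x ^ 2 * L ^ 2 with hs
  have hg : armGap ν x ^ 2 ≤ 1 := pow_le_one₀ hx.le (armGap_le_one ν x)
  have h1 : 16 * α ≤ 16 * α / armGap ν x ^ 2 := by
    rw [le_div_iff₀ (by positivity)]; nlinarith
  have hs0 : 0 < s := by positivity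
  have hsT : 16 * α / armGap ν x ^ 2 * L ≤ s := by
    rw [hs]
    gcongr
    nlinarith
  have hsL : L ^ 2 ≤ s / 2 := by
    have : 2 * L ^ 2 ≤ 16 * α / armGap ν x ^ 2 * L ^ 2 := by gcongr; linarith
    linarith
  have hKpos : (0 : ℝ) < Fintype.card X := by exact_mod_cast Fintype.card_pos
  -- Pigeonhole: more than `1 + K s` calls force some machine to have suggested `x` more than `s`
  -- times.
  have hsub : {p : ((X × X) × (X → M)) × (Fin T → (X × X) × ((I × I) × Bool)) |
      B < visits (leftArm x) p.2} ≤ᵐ[P] (⋃ z ∈ Finset.univ, {p | s < rightCount z x T p.2} :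
        Set (((X × X) × (X → M)) × (Fin T → (X × X) × ((I × I) × Bool)))) := by
    filter_upwards [ae_visits_leftArm_le S y₀ ν T x] with p hp hpx
    change B < visits (leftArm x) p.2 at hpx
    by_contra hnot
    have hall : ∀ z ∈ Finset.univ, rightCount z x T p.2 ≤ s := by
      intro z _
      by_contra hz
      refine hnot ?_
      change p ∈ ⋃ z ∈ Finset.univ, {p | s < rightCount z x T p.2}
      simp only [Set.mem_iUnion]
      exact ⟨z, Finset.mem_univ z, not_le.1 hz⟩
    have h2 := Finset.sum_le_sum hall
    simp only [Finset.sum_const, Finset.card_univ, nsmul_eq_mul] at h2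
    have h3 : (B : ℝ) < visits (leftArm x) p.2 := by exact_mod_cast hpx
    linarith
  have htail : (s / 2) ^ (-α) ≤ 1 / (Fintype.card X * L) := by
    have hLL : Fintype.card X * L ≤ (s / 2) ^ α := by
      calc Fintype.card X * L ≤ L ^ α * L ^ α := by
            refine mul_le_mul hK ?_ (by linarith) (by positivity)
            calc L = L ^ (1 : ℝ) := (Real.rpow_one L).symm
              _ ≤ L ^ α := Real.rpow_le_rpow_of_exponent_le (by linarith) (by linarith)
        _ = (L ^ 2) ^ α := by rw [← Real.mul_rpow (by linarith) (by linarith), sq]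
        _ ≤ _ := Real.rpow_le_rpow (by positivity) hsL (by linarith)
    rw [Real.rpow_neg (by positivity), ← one_div]
    exact one_div_le_one_div_of_le (by positivity) hLL
  refine (ENNReal.toReal_mono (measure_ne_top _ _) (measure_mono_ae hsub)).trans ?_
  refine (measureReal_biUnion_finset_le _ _).trans ?_
  calc _ ≤ ∑ z : X, 2 / α * (1 / (Fintype.card X * L)) := by
        refine Finset.sum_le_sum fun z _ => (gameLaw_tail hS y₀ ν z hx T T hs0 hsT).trans ?_
        gcongr
    _ = _ := by
        simp only [Finset.sum_const, Finset.card_univ, nsmul_eq_mul]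
        field_simp

/-- The machine of a suboptimal arm is rarely called, hence its counts are small. -/
theorem integral_rightCount_le_of_gap {S : X → SBM X M} {α : ℝ} (hα : 3 ≤ α)
    (hS : ∀ x, (S x).IsRobust α) (y₀ : X) (ν : Kernel X I) [IsMarkovKernel ν] {x y : X}
    (hx : 0 < armGap ν x) (hy : 0 < armGap ν y) {T : ℕ} (hT : 3 ≤ T)
    (hK : (Fintype.card X : ℝ) ≤ Real.log T ^ α) {B : ℕ} (hB3 : 3 ≤ B)
    (hB : 1 + Fintype.card X * (16 * α / armGap ν x ^ 2 * Real.log T ^ 2) ≤ B) :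
    ∫ p, rightCount x y T p.2 ∂(multiSBM S y₀).gameLaw ν T ≤
      16 * α / armGap ν y ^ 2 * Real.log B + 2 + 32 / armGap ν y ^ 2 := by
  have hL := one_le_log_of_three_le hT
  set P := (multiSBM S y₀).gameLaw ν T
  set s := 16 * α / armGap ν y ^ 2 * Real.log T with hs
  have hs0 : 0 ≤ s := by positivity
  have hset : MeasurableSet {p : ((X × X) × (X → M)) × (Fin T → (X × X) × ((I × I) × Bool)) |
      B < visits (leftArm x) p.2} := measurableSet_lt measurable_const
    ((measurable_visits (measurableSet_leftArm x) T).comp measurable_snd)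
  have hrc : ∀ k, Integrable (fun p => rightCount x y k p.2) P := fun k => Integrable.of_bound
    ((measurable_rightCount x y k T).comp measurable_snd).aestronglyMeasurable T
    (Filter.Eventually.of_forall fun p => by
      rw [Real.norm_eq_abs, abs_of_nonneg (rightCount_nonneg x y k p.2)]
      exact rightCount_le x y k p.2)
  have hmax : Integrable (fun p => max (rightCount x y T p.2 - s) 0) P :=
    ((hrc T).sub (integrable_const s)).pos_part
  have hind : Integrable ({p : ((X × X) × (X → M)) × (Fin T → (X × X) × ((I × I) × Bool)) |
      B < visits (leftArm x) p.2}.indicator fun _ => s) P := (integrable_const s).indicator hset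
  have hsum : Integrable (fun p => rightCount x y B p.2 +
      {p : ((X × X) × (X → M)) × (Fin T → (X × X) × ((I × I) × Bool)) |
        B < visits (leftArm x) p.2}.indicator (fun _ => s) p) P := (hrc B).add hind
  -- If there are at most `B` calls, the count capped at `B` is the full count. Otherwise the count
  -- is split at the horizon-`T` threshold `s`, whose excess has expectation at most `1`.
  have hpt : ∀ p : ((X × X) × (X → M)) × (Fin T → (X × X) × ((I × I) × Bool)),
      rightCount x y T p.2 ≤ (rightCount x y B p.2 +
        {p : ((X × X) × (X → M)) × (Fin T → (X × X) × ((I × I) × Bool)) |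
          B < visits (leftArm x) p.2}.indicator (fun _ => s) p) +
        max (rightCount x y T p.2 - s) 0 := by
    intro p
    have h1 := le_max_left (rightCount x y T p.2 - s) 0
    have h2 := le_max_right (rightCount x y T p.2 - s) 0
    have h3 := rightCount_nonneg x y B p.2
    by_cases hp : B < visits (leftArm x) p.2
    · rw [Set.indicator_of_mem (show p ∈ {p | B < visits (leftArm x) p.2} from hp)]
      linarith
    · rw [Set.indicator_of_notMem (show p ∉ {p | B < visits (leftArm x) p.2} from hp),
        rightCount_eq_sum x y p.2 (visits_le _ _), rightCount_eq_sum x y p.2 (not_lt.1 hp)]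
      rw [rightCount_eq_sum x y p.2 (visits_le _ _)] at h2
      linarith
  refine (integral_mono (hrc T) (hsum.add hmax) hpt).trans ?_
  rw [integral_add' hsum hmax, integral_add (hrc B) hind, integral_indicator_const _ hset]
  have h1 := integral_rightCount_le hα hS y₀ ν x hy hB3 T
  have h2 := integral_rightCount_excess_le hα hS y₀ ν x hy hT T
  -- The probability `2 / (α ln T)` cancels both `α` and `ln T` in `s`.
  have h3 : P.real {p | B < visits (leftArm x) p.2} • s ≤ 32 / armGap ν y ^ 2 := by
    rw [smul_eq_mul]
    calc _ ≤ 2 / (α * Real.log T) * s :=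
          mul_le_mul_of_nonneg_right (visits_leftArm_tail hα hS y₀ ν hx hT hK hB) hs0
      _ = _ := by rw [hs]; field_simp; norm_num
  linarith

end Counts

/-! ### Numerical estimates for the parameter and the call bound. -/

section Numeric

theorem three_le_robustnessParam (K T : ℕ) : 3 ≤ robustnessParam K T := le_max_left _ _

theorem log_log_ge {T : ℕ} (hT : 3 ≤ T) : 1 / 12.2 ≤ Real.log (Real.log T) := by
  have hL := one_le_log_of_three_le hT
  have h1 := Real.one_sub_inv_le_log_of_pos (show 0 < Real.log T by linarith)
  have h2 : (Real.log T)⁻¹ ≤ 1.09⁻¹ := inv_anti₀ (by norm_num) hL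
  norm_num at h2 ⊢
  linarith

/-- A crude linear bound suffices, because it is only used for `ln α` inside the logarithm of the
call bound. -/
theorem robustnessParam_le {K T : ℕ} (hK : 1 ≤ K) (hT : 3 ≤ T) :
    robustnessParam K T ≤ 16 * K := by
  have hK' : (1 : ℝ) ≤ K := by exact_mod_cast hK
  have h1 := log_log_ge hT
  have h0 : 0 < Real.log (Real.log T) := lt_of_lt_of_le (by norm_num) h1
  refine max_le (by linarith) ?_
  rw [div_le_iff₀ h0]
  have h2 := Real.log_le_sub_one_of_pos (show (0 : ℝ) < K by linarith)
  norm_num at h1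
  nlinarith

/-- The reason for the term `ln K / ln ln T` in the parameter: the union over `K` machines is
absorbed by one power `(ln T)^α`. -/
theorem card_le_log_rpow {K T : ℕ} (hK : 1 ≤ K) (hT : 3 ≤ T) :
    (K : ℝ) ≤ Real.log T ^ robustnessParam K T := by
  have hK' : (1 : ℝ) ≤ K := by exact_mod_cast hK
  have hL := one_le_log_of_three_le hT
  have h0 : 0 < Real.log (Real.log T) := lt_of_lt_of_le (by norm_num) (log_log_ge hT)
  have h1 : Real.log K / Real.log (Real.log T) ≤ robustnessParam K T := le_max_right _ _
  rw [div_le_iff₀ h0] at h1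
  rw [Real.rpow_def_of_pos (by linarith), ← Real.log_le_iff_le_exp (by linarith)]
  linarith

/-- A bound for the number of calls to the machine of an arm with gap `δ`. -/
theorem exists_call_bound {K : ℕ} (hK : 2 ≤ K) {L δ α : ℝ} (hL : 1 ≤ L) (hδ : 0 < δ) (hδ1 : δ ≤ 1)
    (hα : 3 ≤ α) (hαK : α ≤ 16 * K) :
    ∃ B : ℕ, 3 ≤ B ∧ 1 + K * (16 * α / δ ^ 2 * L ^ 2) ≤ B ∧
      Real.log B ≤ 11 * (Real.log K + Real.log L - Real.log δ) := by
  have hK' : (2 : ℝ) ≤ K := by exact_mod_cast hK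
  set w := K * (16 * α / δ ^ 2 * L ^ 2) with hw
  have hδ2 : δ ^ 2 ≤ 1 := pow_le_one₀ hδ.le hδ1
  have h1 : 16 * α ≤ 16 * α / δ ^ 2 := by
    rw [le_div_iff₀ (by positivity)]; nlinarith
  have hL2 : 1 ≤ L ^ 2 := one_le_pow₀ hL
  have h2 : 16 * α ≤ 16 * α / δ ^ 2 * L ^ 2 := by nlinarith
  have hw48 : 48 ≤ w := by rw [hw]; nlinarith
  refine ⟨⌈1 + w⌉₊, ?_, Nat.le_ceil _, ?_⟩
  · have : (3 : ℝ) ≤ (⌈1 + w⌉₊ : ℝ) := le_trans (by linarith) (Nat.le_ceil (1 + w))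
    exact_mod_cast this
  have hB : (⌈1 + w⌉₊ : ℝ) ≤ 2 * w := by
    have := Nat.ceil_lt_add_one (show 0 ≤ 1 + w by linarith)
    linarith
  have hlog2 : Real.log 2 ≤ Real.log K := Real.log_le_log (by norm_num) hK'
  have hlogα : Real.log α ≤ 4 * Real.log 2 + Real.log K := by
    have h3 := Real.log_le_log (by linarith) hαK
    rw [Real.log_mul (by norm_num) (by linarith), show (16 : ℝ) = 2 ^ 4 by norm_num,
      Real.log_pow] at h3
    exact_mod_cast h3
  -- As `ln 2 ≤ ln K`, the terms `5 ln 2 + ln K + ln α` amount to at most `5 + 1 + 5 = 11` copies of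
  -- `ln K`.
  have hlogw : Real.log (2 * w) =
      5 * Real.log 2 + Real.log K + Real.log α - 2 * Real.log δ + 2 * Real.log L := by
    rw [show 2 * w = 2 ^ 5 * K * α * L ^ 2 / δ ^ 2 by rw [hw]; ring,
      Real.log_div (by positivity) (by positivity), Real.log_mul (by positivity) (by positivity),
      Real.log_mul (by positivity) (by positivity), Real.log_mul (by positivity) (by positivity),
      Real.log_pow, Real.log_pow, Real.log_pow]
    push_cast
    ring
  have h4 : Real.log (⌈1 + w⌉₊ : ℝ) ≤ Real.log (2 * w) :=
    Real.log_le_log (lt_of_lt_of_le (by linarith) (Nat.le_ceil (1 + w))) hB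
  have h5 : 0 ≤ Real.log L := Real.log_nonneg hL
  have h6 : Real.log δ ≤ 0 := Real.log_nonpos hδ.le hδ1
  linarith

end Numeric

/-! ### Assembling the regret bounds. -/

section Regret

variable {X : Type u} [Fintype X] [DecidableEq X] [Nonempty X] [MeasurableSpace X]
  [DiscreteMeasurableSpace X] {ν : Kernel X I} {xs : X}

omit [Fintype X] [DecidableEq X] [Nonempty X] [DiscreteMeasurableSpace X] in
theorem iSup_armMean_eq [IsMarkovKernel ν]
    (hxs : ∀ x, x ≠ xs → armMean ν x < armMean ν xs) : ⨆ z, armMean ν z = armMean ν xs := by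
  have : Nonempty X := ⟨xs⟩
  refine le_antisymm (ciSup_le fun z => ?_) (le_ciSup (bddAbove_armMean ν) xs)
  rcases eq_or_ne z xs with rfl | hz
  · exact le_rfl
  · exact (hxs z hz).le

omit [Fintype X] [DecidableEq X] [Nonempty X] [DiscreteMeasurableSpace X] in
theorem armGap_best [IsMarkovKernel ν] (hxs : ∀ x, x ≠ xs → armMean ν x < armMean ν xs) :
    armGap ν xs = 0 := by
  rw [armGap, iSup_armMean_eq hxs, sub_self]

omit [Fintype X] [DecidableEq X] [Nonempty X] [DiscreteMeasurableSpace X] in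
theorem armGap_pos [IsMarkovKernel ν] (hxs : ∀ x, x ≠ xs → armMean ν x < armMean ν xs) {x : X}
    (hx : x ≠ xs) : 0 < armGap ν x := by
  rw [armGap, iSup_armMean_eq hxs]
  linarith [hxs x hx]

omit [Nonempty X] [DiscreteMeasurableSpace X] in
theorem gapComplexity_nonneg [IsMarkovKernel ν] (xs : X) : 0 ≤ gapComplexity ν xs :=
  Finset.sum_nonneg fun x _ => one_div_nonneg.2 (armGap_nonneg ν x)

-- Gaps are at most `1`, so `Δ ≤ 1 / Δ`. This absorbs the cost of the arbitrary initial arm.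
omit [Nonempty X] [DiscreteMeasurableSpace X] in
theorem armGap_le_gapComplexity [IsMarkovKernel ν]
    (hxs : ∀ x, x ≠ xs → armMean ν x < armMean ν xs) (x : X) :
    armGap ν x ≤ gapComplexity ν xs := by
  rcases eq_or_ne x xs with rfl | hx
  · rw [armGap_best hxs]; exact gapComplexity_nonneg x
  · have h0 := armGap_pos hxs hx
    have h1 : armGap ν x ≤ 1 / armGap ν x := by
      rw [le_div_iff₀ h0]
      have := armGap_le_one ν x
      nlinarith
    exact h1.trans (Finset.single_le_sum (f := fun x => 1 / armGap ν x)
      (fun z _ => one_div_nonneg.2 (armGap_nonneg ν z)) (by simp [hx]))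

/-- The expected number of rounds of MultiSBM in which the right arm is `y`. -/
theorem sum_integral_rightCount_le [IsMarkovKernel ν]
    (hxs : ∀ x, x ≠ xs → armMean ν x < armMean ν xs) {T : ℕ} (hT : 3 ≤ T)
    {M : Type v} [MeasurableSpace M] {S : X → SBM X M} (y₀ : X)
    (hS : ∀ x, (S x).IsRobust (robustnessParam (Fintype.card X) T)) {y : X} (hy : y ≠ xs) :
    armGap ν y * ∑ x, ∫ p, rightCount x y T p.2 ∂(multiSBM S y₀).gameLaw ν T ≤
      1 / armGap ν y * (robustnessParam (Fintype.card X) T * (17 * Real.log T +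
        200 * ∑ x ∈ Finset.univ.erase xs,
          (Real.log (Fintype.card X) + Real.log (Real.log T) - Real.log (armGap ν x)))) := by
  have hL := one_le_log_of_three_le hT
  have hK1 : 1 ≤ Fintype.card X := Fintype.card_pos
  -- A suboptimal arm exists, so `ln K ≥ ln 2`; this keeps `Λ` below away from zero and lets it
  -- absorb constants.
  have hK2 : 2 ≤ Fintype.card X := Fintype.one_lt_card_iff.2 ⟨y, xs, hy⟩
  have hα := three_le_robustnessParam (Fintype.card X) T
  have hαK := robustnessParam_le hK1 hT
  have hKL := card_le_log_rpow hK1 hT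
  set α := robustnessParam (Fintype.card X) T
  set L := Real.log T
  have hgy := armGap_pos hxs hy
  have hgy1 := armGap_le_one ν y
  set δ := armGap ν y
  have hδ2 : δ ^ 2 ≤ 1 := pow_le_one₀ hgy.le hgy1
  have hbig : 3 ≤ α / δ ^ 2 := by
    rw [le_div_iff₀ (by positivity)]; nlinarith
  have hbig2 : 3 * (1 / δ ^ 2) ≤ α / δ ^ 2 := by
    rw [mul_one_div]; gcongr
  have hx : ∀ x ∈ Finset.univ.erase xs,
      ∫ p, rightCount x y T p.2 ∂(multiSBM S y₀).gameLaw ν T ≤ α / δ ^ 2 * (200 *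
        (Real.log (Fintype.card X) + Real.log L - Real.log (armGap ν x))) := by
    intro x hx
    have hgx := armGap_pos hxs (Finset.ne_of_mem_erase hx)
    have hgx1 := armGap_le_one ν x
    obtain ⟨B, hB3, hB, hlogB⟩ := exists_call_bound hK2 (show 1 ≤ L by linarith) hgx hgx1 hα hαK
    refine (integral_rightCount_le_of_gap hα hS y₀ ν hgx hgy hT hKL hB3 hB).trans ?_
    set Λ := Real.log (Fintype.card X) + Real.log L - Real.log (armGap ν x)
    have hΛ : 0.69 ≤ Λ := by
      have h1 : Real.log 2 ≤ Real.log (Fintype.card X) :=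
        Real.log_le_log (by norm_num) (by exact_mod_cast hK2)
      have h2 : 0 ≤ Real.log L := Real.log_nonneg (by linarith)
      have h3 : Real.log (armGap ν x) ≤ 0 := Real.log_nonpos hgx.le hgx1
      have := Real.log_two_gt_d9
      change _ ≤ _ + _ - _
      linarith
    have h1 : 16 * α / δ ^ 2 * Real.log B ≤ α / δ ^ 2 * (176 * Λ) := by
      rw [show 16 * α / δ ^ 2 * Real.log B = α / δ ^ 2 * (16 * Real.log B) by ring]
      refine mul_le_mul_of_nonneg_left ?_ (by positivity)
      linarith
    -- The constant `200` is `16 · 11 + 24`; here `24 · 0.69 ≥ 16`, while `α ≥ 3` bounds the left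
    -- side by `16 α / δ²`.
    have h2 : 2 + 32 / δ ^ 2 ≤ α / δ ^ 2 * (24 * Λ) := by
      have h3 : 32 / δ ^ 2 = 32 * (1 / δ ^ 2) := by ring
      have h4 : α / δ ^ 2 * 16 ≤ α / δ ^ 2 * (24 * Λ) := by gcongr; linarith
      linarith
    linarith
  have hbest : ∫ p, rightCount xs y T p.2 ∂(multiSBM S y₀).gameLaw ν T ≤
      α / δ ^ 2 * (17 * L) := by
    refine (integral_rightCount_le hα hS y₀ ν xs hgy hT T).trans ?_
    have h1 : 16 * α / δ ^ 2 * L = α / δ ^ 2 * (16 * L) := by ring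
    change 16 * α / δ ^ 2 * L + 1 ≤ _
    rw [h1]
    nlinarith
  rw [← Finset.add_sum_erase _ _ (Finset.mem_univ xs)]
  have hsum := Finset.sum_le_sum hx
  rw [← Finset.mul_sum, ← Finset.mul_sum] at hsum
  calc _ ≤ δ * (α / δ ^ 2 * (17 * L) + α / δ ^ 2 * (200 * ∑ x ∈ Finset.univ.erase xs,
          (Real.log (Fintype.card X) + Real.log L - Real.log (armGap ν x)))) := by
        gcongr
    _ = _ := by field_simp

theorem multiSBM_regret_le [IsMarkovKernel ν]
    (hxs : ∀ x, x ≠ xs → armMean ν x < armMean ν xs) {T : ℕ} (hT : 3 ≤ T)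
    {M : Type v} [MeasurableSpace M] {S : X → SBM X M} (y₀ : X)
    (hS : ∀ x, (S x).IsRobust (robustnessParam (Fintype.card X) T)) :
    (multiSBM S y₀).expectedRegret ν T ≤
      200 * (gapComplexity ν xs * robustnessParam (Fintype.card X) T * Real.log T +
        gapComplexity ν xs * robustnessParam (Fintype.card X) T *
          ((Fintype.card X : ℝ) * Real.log (Fintype.card X) +
            (Fintype.card X : ℝ) * Real.log (Real.log T) -
            ∑ x ∈ Finset.univ.erase xs, Real.log (armGap ν x))) := by
  have hL := one_le_log_of_three_le hT
  have hα := three_le_robustnessParam (Fintype.card X) T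
  have hH : 0 ≤ gapComplexity ν xs := gapComplexity_nonneg xs
  have h1 := expectedRegret_le S y₀ ν T
  have h2 := armGap_le_gapComplexity hxs y₀
  rw [← Finset.add_sum_erase _ _ (Finset.mem_univ xs), armGap_best hxs, zero_mul, zero_add] at h1
  have h3 := Finset.sum_le_sum fun y (hy : y ∈ Finset.univ.erase xs) =>
    sum_integral_rightCount_le hxs hT y₀ hS (Finset.ne_of_mem_erase hy)
  rw [← Finset.sum_mul] at h3
  change _ ≤ gapComplexity ν xs * _ at h3
  set H := gapComplexity ν xs
  set α := robustnessParam (Fintype.card X) T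
  set L := Real.log T
  have hlogK : 0 ≤ Real.log (Fintype.card X) :=
    Real.log_nonneg (by exact_mod_cast (Fintype.card_pos : 0 < Fintype.card X))
  have hlogL : 0 ≤ Real.log L := Real.log_nonneg (by linarith)
  have hΛ : ∑ x ∈ Finset.univ.erase xs,
        (Real.log (Fintype.card X) + Real.log L - Real.log (armGap ν x)) ≤
      (Fintype.card X : ℝ) * Real.log (Fintype.card X) + (Fintype.card X : ℝ) * Real.log L -
        ∑ x ∈ Finset.univ.erase xs, Real.log (armGap ν x) := by
    rw [Finset.sum_sub_distrib]
    refine sub_le_sub_right ?_ _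
    rw [← mul_add, Finset.sum_const, nsmul_eq_mul]
    refine mul_le_mul_of_nonneg_right ?_ (by linarith)
    exact_mod_cast Finset.card_le_univ _
  set Q := (Fintype.card X : ℝ) * Real.log (Fintype.card X) + (Fintype.card X : ℝ) * Real.log L -
    ∑ x ∈ Finset.univ.erase xs, Real.log (armGap ν x)
  have hHα : 0 ≤ H * α := mul_nonneg hH (by linarith)
  have h4 : H * (α * (17 * L + 200 * ∑ x ∈ Finset.univ.erase xs,
      (Real.log (Fintype.card X) + Real.log L - Real.log (armGap ν x)))) ≤
      H * α * (17 * L + 200 * Q) := by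
    rw [← mul_assoc]
    refine mul_le_mul_of_nonneg_left ?_ hHα
    linarith
  have h5 : H ≤ H * α * L := by
    have : 1 ≤ α * L := by nlinarith
    nlinarith
  have h6 : 0 ≤ H * α * L := mul_nonneg hHα (by linarith)
  linarith

omit [Nonempty X] in
/-- Robustness bounds the expected regret of a single machine. -/
theorem mabRegret_le_of_isRobust [IsMarkovKernel ν]
    (hxs : ∀ x, x ≠ xs → armMean ν x < armMean ν xs) {T : ℕ} (hT : 3 ≤ T)
    {M : Type v} [MeasurableSpace M] {S : SBM X M} (hS : S.IsRobust 3) :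
    S.mabRegret ν T ≤ 13 * (gapComplexity ν xs * Real.log T) := by
  have hL := one_le_log_of_three_le hT
  have hmeas : ∀ x, Measurable fun p : M × (Fin T → X × I) => (playCount x p.2 : ℝ) := by
    intro x
    simp only [playCount_eq_visits]
    exact measurable_from_top.comp
      ((measurable_visits (measurableSet_arm x) T).comp measurable_snd)
  have hle : ∀ x (h : Fin T → X × I), (playCount x h : ℝ) ≤ T := fun x h => by
    rw [playCount_eq_visits]; exact_mod_cast visits_le _ _
  have hint : ∀ x, Integrable (fun p : M × (Fin T → X × I) => (playCount x p.2 : ℝ))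
      (S.mabLaw ν T) := fun x => Integrable.of_bound (hmeas x).aestronglyMeasurable T
    (Filter.Eventually.of_forall fun p => by
      rw [Real.norm_eq_abs, abs_of_nonneg (by positivity)]; exact hle x p.2)
  have hsum : ∀ p : M × (Fin T → X × I), ∑ t, armGap ν (p.2 t).1 =
      ∑ x ∈ Finset.univ.erase xs, armGap ν x * (playCount x p.2 : ℝ) := by
    intro p
    have h1 : ∑ t, armGap ν (p.2 t).1 = ∑ x, armGap ν x * (playCount x p.2 : ℝ) := by
      simp only [playCount_eq_visits, visits, Set.mem_ofPred_eq]
      push_cast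
      simp only [Finset.mul_sum]
      rw [Finset.sum_comm]
      simp
    rw [h1, ← Finset.add_sum_erase _ _ (Finset.mem_univ xs), armGap_best hxs, zero_mul, zero_add]
  rw [mabRegret_eq, integral_congr_ae (Filter.Eventually.of_forall hsum),
    integral_finsetSum _ fun x _ => (hint x).const_mul _]
  simp only [integral_const_mul]
  rw [gapComplexity, Finset.sum_mul, Finset.mul_sum]
  refine Finset.sum_le_sum fun x hx => ?_
  have hgx := armGap_pos hxs (Finset.ne_of_mem_erase hx)
  have hgx1 := armGap_le_one ν x
  have hδ2 : armGap ν x ^ 2 ≤ 1 := pow_le_one₀ hgx.le hgx1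
  have hbig : 12 ≤ 4 * 3 / armGap ν x ^ 2 := by
    rw [le_div_iff₀ (by positivity)]; nlinarith
  have hs₀ : 4 ≤ 4 * 3 / armGap ν x ^ 2 * Real.log T := by nlinarith
  have hexc := integral_excess_le (P := S.mabLaw ν T) (hmeas x) (fun p => hle x p.2) le_rfl hs₀
    fun s hs => (hS ν T x hgx s (by linarith) hs).le
  have hE := integral_le_of_excess (hmeas x) (fun p => by positivity) (fun p => hle x p.2)
    (by linarith) hexc
  have h1 : 1 ≤ 1 / armGap ν x ^ 2 * Real.log T := by
    have : 1 ≤ 1 / armGap ν x ^ 2 := by rw [le_div_iff₀ (by positivity)]; linarith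
    nlinarith
  calc _ ≤ armGap ν x * (4 * 3 / armGap ν x ^ 2 * Real.log T + 1) :=
        mul_le_mul_of_nonneg_left hE hgx.le
    _ ≤ armGap ν x * (13 * (1 / armGap ν x ^ 2 * Real.log T)) := by
        refine mul_le_mul_of_nonneg_left ?_ hgx.le
        rw [show 4 * 3 / armGap ν x ^ 2 * Real.log T =
          12 * (1 / armGap ν x ^ 2 * Real.log T) by ring]
        linarith
    _ = _ := by field_simp

/-- For large horizons the logarithm dominates the lower order terms. -/
theorem eventually_log_dominates (K : ℕ) (D : ℝ) : ∀ᶠ T : ℕ in Filter.atTop,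
    3 ≤ T ∧ robustnessParam K T = 3 ∧
      K * Real.log K + K * Real.log (Real.log T) - D ≤ Real.log T := by
  have hlog : Filter.Tendsto (fun T : ℕ => Real.log T) Filter.atTop Filter.atTop :=
    Real.tendsto_log_atTop.comp tendsto_natCast_atTop_atTop
  have hloglog := Real.tendsto_log_atTop.comp hlog
  have h1 : ∀ᶠ L : ℝ in Filter.atTop, K * Real.log K + K * Real.log L - D ≤ L := by
    have ho : (fun L : ℝ => (K * Real.log K - D) + K * Real.log L) =o[Filter.atTop] (id : ℝ → ℝ) :=
      (Asymptotics.isLittleO_const_id_atTop _).add (Real.isLittleO_log_id_atTop.const_mul_left _)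
    filter_upwards [ho.bound one_pos, Filter.eventually_ge_atTop 0] with L hL hL0
    simp only [Real.norm_eq_abs, id, one_mul, abs_of_nonneg hL0] at hL
    linarith [le_abs_self (K * Real.log K - D + K * Real.log L)]
  filter_upwards [hlog.eventually h1, Filter.eventually_ge_atTop 3,
    hloglog.eventually_ge_atTop (max 1 (Real.log K / 3))] with T hT hT3 hll
  refine ⟨hT3, max_eq_left ?_, hT⟩
  simp only [Function.comp_apply] at hll
  have h2 := (le_max_left _ _).trans hll
  have h3 := (le_max_right _ _).trans hll
  rw [div_le_iff₀ (by linarith)]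
  linarith

end Regret

end

/-! ### The theorem. -/

theorem mainTheorem2 :
    -- The regret bound, with an absolute constant, and its form for large horizons.
    (∃ C : ℝ, 0 < C ∧
      ∀ (X : Type u) [Fintype X] [DecidableEq X] [Nonempty X] [MeasurableSpace X]
        [DiscreteMeasurableSpace X] (ν : Kernel X I) [IsMarkovKernel ν] (xs : X),
        (∀ x, x ≠ xs → armMean ν x < armMean ν xs) →
        (∀ (T : ℕ), 3 ≤ T →
          ∀ (M : Type v) [MeasurableSpace M] (S : X → SBM X M) (y₀ : X),
            (∀ x, (S x).IsRobust (robustnessParam (Fintype.card X) T)) →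
            (multiSBM S y₀).expectedRegret ν T ≤
              C * (gapComplexity ν xs * robustnessParam (Fintype.card X) T * Real.log T +
                gapComplexity ν xs * robustnessParam (Fintype.card X) T *
                  ((Fintype.card X : ℝ) * Real.log (Fintype.card X) +
                    (Fintype.card X : ℝ) * Real.log (Real.log T) -
                    ∑ x ∈ Finset.univ.erase xs, Real.log (armGap ν x)))) ∧
        (∃ T₀ : ℕ, ∀ T : ℕ, T₀ ≤ T →
          (∀ (M : Type v) [MeasurableSpace M] (S : X → SBM X M) (y₀ : X),
            (∀ x, (S x).IsRobust 3) →
            (multiSBM S y₀).expectedRegret ν T ≤ C * (gapComplexity ν xs * Real.log T)) ∧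
          (∀ (sel : Kernel (UCBState X) X) [IsMarkovKernel sel], IsUCBSelection 3 sel →
            (ucb sel).mabRegret ν T ≤ C * (gapComplexity ν xs * Real.log T)))) ∧
    -- Robustness is ensured by UCB.
    (∀ (X : Type u) [Fintype X] [DecidableEq X] [Nonempty X] [MeasurableSpace X]
      [DiscreteMeasurableSpace X] (T : ℕ), 3 ≤ T →
      ∀ (sel : Kernel (UCBState X) X) [IsMarkovKernel sel],
        IsUCBSelection (robustnessParam (Fintype.card X) T) sel →
        (ucb sel).IsRobust (robustnessParam (Fintype.card X) T)) := by
  -- For large `T` the general bound with constant `200` and `α = 3` consists of two terms of at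
  -- most `3 H ln T` each, and `200 · 6 = 1200`.
  refine ⟨⟨1200, by norm_num, ?_⟩, ?_⟩
  · intro X _ _ _ _ _ ν _ xs hxs
    have hH : 0 ≤ gapComplexity ν xs := gapComplexity_nonneg xs
    refine ⟨fun T hT M _ S y₀ hS => ?_, ?_⟩
    · refine (multiSBM_regret_le hxs hT y₀ hS).trans ?_
      have hL := one_le_log_of_three_le hT
      have hα := three_le_robustnessParam (Fintype.card X) T
      have hK : (1 : ℝ) ≤ Fintype.card X := by
        exact_mod_cast (Fintype.card_pos : 0 < Fintype.card X)
      have hlogK := Real.log_nonneg hK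
      have hlogL : 0 ≤ Real.log (Real.log T) := Real.log_nonneg (by linarith)
      have hD : ∑ x ∈ Finset.univ.erase xs, Real.log (armGap ν x) ≤ 0 :=
        Finset.sum_nonpos fun x _ => Real.log_nonpos (armGap_nonneg ν x) (armGap_le_one ν x)
      refine mul_le_mul_of_nonneg_right (by norm_num) (add_nonneg (by positivity)
        (mul_nonneg (by positivity) ?_))
      have h1 : 0 ≤ (Fintype.card X : ℝ) * Real.log (Fintype.card X) := by positivity
      have h2 : 0 ≤ (Fintype.card X : ℝ) * Real.log (Real.log T) := by positivity
      linarith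
    · obtain ⟨T₀, hT₀⟩ := Filter.eventually_atTop.1 (eventually_log_dominates (Fintype.card X)
        (∑ x ∈ Finset.univ.erase xs, Real.log (armGap ν x)))
      refine ⟨T₀, fun T hT => ?_⟩
      obtain ⟨hT3, hα, hQ⟩ := hT₀ T hT
      have hL := one_le_log_of_three_le hT3
      refine ⟨fun M _ S y₀ hS => ?_, fun sel _ hsel => ?_⟩
      · refine (multiSBM_regret_le hxs hT3 y₀ (by rwa [hα])).trans ?_
        rw [hα]
        have := mul_le_mul_of_nonneg_left hQ (show 0 ≤ gapComplexity ν xs * 3 by positivity)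
        linarith
      · refine (mabRegret_le_of_isRobust hxs hT3 (ucb_isRobust le_rfl hsel)).trans ?_
        refine mul_le_mul_of_nonneg_right (by norm_num) (by positivity)
  · intro X _ _ _ _ _ T _ sel _ hsel
    exact ucb_isRobust (three_le_robustnessParam _ _) hsel
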